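/- Let $\vec a=(a_1,\dots,a_n)$ with all $a_i\ge 1$, let $\vec p=(p_1,\dots,p_n)$ with $0<p_i\le\infty$, and let $\|f|L_{\vec p}(\mathbb R^n)\|=\big(\int_{\mathbb R}\big(\dots\big(\int_{\mathbb R}|f(x)|^{p_1}\,dx_1\big)^{p_2/p_1}\dots\big)^{p_n/p_{n-1}}dx_n\big)^{1/p_n}$ be the mixed Lebesgue quasi-norm (essential supremum over $x_j$ if $p_j=\infty$). For $t>0$ put $t^{\vec a}x=(t^{a_1}x_1,\dots,t^{a_n}x_n)$, and let $|x|_{\vec a}$ be the unique $t>0$ for which $t^{-\vec a}x=(t^{-1})^{\vec a}x$ lies on the Euclidean unit sphere if $x\ne0$, and $|0|_{\vec a}=0$. Fix $\psi\in C_0^\infty(\mathbb R^n)$ with $0\le\psi\le1$, $\psi(\xi)=1$ for $|\xi|_{\vec a}\le1$ and $\psi(\xi)=0$ for $|\xi|_{\vec a}\ge 3/2$; put $\Phi=\psi-\psi(2^{\vec a}\cdot)$, $\Phi_0=\psi$, $\Phi_j(\xi)=\Phi((2^{-j})^{\vec a}\xi)$ for $j\ge1$, and $u_j=\mathcal F^{-1}(\Phi_j\mathcal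 Fu)$ for $u\in\mathcal S'(\mathbb R^n)$, where $\mathcal Fg(\xi)=\int_{\mathbb R^n} e^{-\mathrm i x\cdot\xi}g(x)\,dx$. For $s\in\mathbb R$ and $0<q\le\infty$ the Besov space $B^{s,\vec a}_{\vec p,q}$ consists of all $u\in\mathcal S'(\mathbb R^n)$ with $\|u|B^{s,\vec a}_{\vec p,q}\|=\big(\sum_{j=0}^\infty 2^{jsq}\|u_j|L_{\vec p}(\mathbb R^n)\|^q\big)^{1/q}<\infty$ (supremum over $j$ of $2^{js}\|u_j|L_{\vec p}(\mathbb R^n)\|$ if $q=\infty$). Let $C>0$ and let $\vec r=(r_1,\dots,r_n)\in\mathbb R^n$ satisfy $$r_l>\frac1{\min(p_1,\dots,p_l)},\qquad l=1,\dots,n.$$ Put $d=\min(1,p_1,\dots,p_n)$ and $s=\vec a\cdot\vec r=\sum_{l=1}^n a_lr_l$. Then there is a constant $c$ such that every $u\in B^{s,\vec a}_{\vec p,d}$ is (represented by) a continuous function, again denoted by $u$, and $$\Big\|\sup_{|x-y|<C}|u(y)|\,\Big|\,L_{\vec p}(\mathbb R^n_x)\Big\|\le c\,\|u|B^{s,\vec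 a}_{\vec p,d}\|,$$ where $|x-y|$ is the Euclidean distance. -/

import Mathlib

open MeasureTheory
open scoped ENNReal NNReal SchwartzMap

noncomputable section

namespace MixedNormBesov

/-- `ℝⁿ` with its Euclidean norm and Lebesgue measure. -/
abbrev Rn (n : ℕ) : Type := EuclideanSpace ℝ (Fin n)

/-- Iterated Lebesgue (quasi-)norm of a `[0,∞]`-valued function of `n` real variables: the norm of
`L_{p₁}` in the first variable is innermost, the norm of `L_{pₙ}` in the last variable is
outermost. For an infinite exponent, `eLpNorm` is the essential supremum. -/
def mixedNormAux : (n : ℕ) → (Fin n → ℝ≥0∞) → ((Fin n → ℝ) → ℝ≥0∞) → ℝ≥0∞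
  | 0, _, f => f 0
  | n + 1, p, f =>
      eLpNorm
        (fun t : ℝ => mixedNormAux n (Fin.init p) (fun x => f (Fin.snoc (α := fun _ => ℝ) x t)))
        (p (Fin.last n)) volume

/-- The mixed norm `‖f | L_p(ℝⁿ)‖` of a nonnegative function on `ℝⁿ`. -/
def mixedNorm {n : ℕ} (p : Fin n → ℝ≥0∞) (f : Rn n → ℝ≥0∞) : ℝ≥0∞ :=
  mixedNormAux n p (fun x => f (WithLp.toLp 2 x))

/-- The quasi-homogeneous dilation `t^a x = (t^{a₁} x₁, …, t^{aₙ} xₙ)`. -/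
def anisoDilation {n : ℕ} (a : Fin n → ℝ) (t : ℝ) (x : Rn n) : Rn n :=
  WithLp.toLp 2 (fun i => t ^ a i * x i)

/-- The anisotropic distance function: for `x ≠ 0` the set below consists of the single `t > 0`
with `t^{-a} x` on the unit sphere; for `x = 0` the set is empty and the value is `0`. -/
def anisoDist {n : ℕ} (a : Fin n → ℝ) (x : Rn n) : ℝ :=
  sInf {t : ℝ | 0 < t ∧ ‖anisoDilation a t⁻¹ x‖ = 1}

/-- The cut-off functions from which the anisotropic Littlewood-Paley decompositions are made. -/
structure IsCutoff {n : ℕ} (a : Fin n → ℝ) (ψ : Rn n → ℝ) : Prop where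
  contDiff : ContDiff ℝ ((⊤ : ℕ∞) : WithTop ℕ∞) ψ
  hasCompactSupport : HasCompactSupport ψ
  nonneg : ∀ ξ, 0 ≤ ψ ξ
  le_one : ∀ ξ, ψ ξ ≤ 1
  eq_one : ∀ ξ, anisoDist a ξ ≤ 1 → ψ ξ = 1
  eq_zero : ∀ ξ, 3 / 2 ≤ anisoDist a ξ → ψ ξ = 0

/-- The Littlewood-Paley decomposition: `Φ₀ = ψ` and `Φ_j = Φ (2^{-ja} ·)` for `j ≥ 1`, where
`Φ = ψ - ψ (2^a ·)`. -/
def dyadicPiece {n : ℕ} (a : Fin n → ℝ) (ψ : Rn n → ℝ) : ℕ → Rn n → ℝ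
  | 0 => ψ
  | j + 1 => fun ξ =>
      ψ (anisoDilation a ((2 : ℝ) ^ (-((j : ℝ) + 1))) ξ) -
        ψ (anisoDilation a 2 (anisoDilation a ((2 : ℝ) ^ (-((j : ℝ) + 1))) ξ))

/-- The tempered distribution `u_j = ℱ⁻¹ (Φ_j ℱ u)` for the Fourier transformation
`ℱ g (ξ) = ∫ e^{-i x·ξ} g(x) dx`. Mathlib's `𝓕` has the kernel `e^{-2πi x·ξ}`, so that in terms of
it the same operator has the symbol `ξ ↦ Φ_j (2πξ)`. -/
def freqBlock {n : ℕ} (a : Fin n → ℝ) (ψ : Rn n → ℝ) (j : ℕ) (u : 𝓢'(Rn n, ℂ)) : 𝓢'(Rn n, ℂ) :=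
  TemperedDistribution.fourierMultiplierCLM ℂ
    (fun ξ => ((dyadicPiece a ψ j ((2 * Real.pi) • ξ) : ℝ) : ℂ)) u

/-- The tempered distribution `v` is the function `f`, i.e. `⟨v, φ⟩ = ∫ φ f dx` for all `φ ∈ 𝓢`. -/
def IsRepresentedBy {n : ℕ} (v : 𝓢'(Rn n, ℂ)) (f : Rn n → ℂ) : Prop :=
  ∀ φ : 𝓢(Rn n, ℂ), Integrable (fun x => φ x * f x) ∧ v φ = ∫ x, φ x * f x

/-- The mixed norm `‖v | L_p(ℝⁿ)‖` of a tempered distribution that is a continuous function, and `∞`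
for any other tempered distribution. The continuous function is unique, so that the infimum is over
at most one `f`. It is used for the `u_j` only; these have compact spectrum, hence are always (smooth)
functions. -/
def distMixedNorm {n : ℕ} (p : Fin n → ℝ≥0∞) (v : 𝓢'(Rn n, ℂ)) : ℝ≥0∞ :=
  ⨅ (f : Rn n → ℂ) (_ : Continuous f ∧ IsRepresentedBy v f), mixedNorm p (fun x => ‖f x‖ₑ)

/-- The quasi-norm `‖u | B^{s,a}_{p,q}‖ = (∑_j 2^{jsq} ‖u_j | L_p‖^q)^{1/q}` (the supremum over `j` of
`2^{js} ‖u_j | L_p‖` for `q = ∞`), formed with the Littlewood-Paley decomposition given by `ψ`. The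
space `B^{s,a}_{p,q}` consists of the `u ∈ 𝓢'` for which it is finite. -/
def besovNorm {n : ℕ} (a : Fin n → ℝ) (ψ : Rn n → ℝ) (s : ℝ) (p : Fin n → ℝ≥0∞) (q : ℝ≥0∞)
    (u : 𝓢'(Rn n, ℂ)) : ℝ≥0∞ :=
  if q = ∞ then ⨆ j : ℕ, (2 : ℝ≥0∞) ^ ((j : ℝ) * s) * distMixedNorm p (freqBlock a ψ j u)
  else
    (∑' j : ℕ, (2 : ℝ≥0∞) ^ ((j : ℝ) * s * q.toReal) *
      distMixedNorm p (freqBlock a ψ j u) ^ q.toReal) ^ (1 / q.toReal)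

end MixedNormBesov

end

namespace MixedNormBesov

/-! ### Minkowski's integral inequality for `[0,∞]`-valued functions -/

section Minkowski

variable {α β : Type*} [MeasurableSpace α] [MeasurableSpace β] {ν : Measure α} {μ : Measure β}

/-! The block `u_j` has spectrum in a quasi-homogeneous ball of size `R = 2^j`, so it is essentially
constant on boxes with sides `R^{-a_l}`. Its supremum over a ball of radius `C` is thus controlled
by a maximum over a grid with `O(R^{a_l})` points in direction `l`. A maximum over `N` points in
direction `l` costs `N^{1/τ}` in the mixed norm when `τ ≤ p_1, …, p_l`: it is estimated inside the
norms in the later variables, so their exponents play no role (`mixedNormAux_iSup_grid_le`). The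
choice `τ = 1/r_l` is admissible, and the total cost is `∏ R^{a_l r_l} = 2^{js}`, which is the
weight in the Besov norm.

"Essentially constant" means the Peetre and Fefferman-Stein inequality
`exists_rpow_mul_dilWeight_le`, which bounds `|f(y)|^t` by weighted averages of `|f|^t` near `y`,
uniformly in the dilation. For `t = min(1, p_1, …, p_n)` these averages are bounded in the mixed
norm, because `t`-th powers reduce to exponents `p_i / t ≥ 1`, where Minkowski's inequality holds.
Together this gives the estimate `exists_mixedNorm_iSup_le` of one block.

The same reduction gives a `t`-triangle inequality for series, which sums the blocks. Since local
suprema control point values (`exists_enorm_le_mixedNorm_iSup`), the series also converges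
uniformly. Its continuous sum represents `u` because the Littlewood-Paley sums tend to `u` in `𝓢'`.
-/

lemma measurable_eLpNorm_param [SFinite μ] {F : α → β → ℝ≥0∞}
    (hF : Measurable (Function.uncurry F)) (q : ℝ≥0∞) : Measurable fun a => eLpNorm (F a) q μ := by
  rcases eq_or_ne q 0 with rfl | hq0
  · simp
  rcases eq_or_ne q ∞ with rfl | hq
  · refine measurable_of_Iic fun c => ?_
    -- An essential supremum is at most `c` iff the section of `{F > c}` is null, and measures of
    -- sections are measurable.
    have : (fun a => eLpNorm (F a) ∞ μ) ⁻¹' Set.Iic c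
        = {a | μ (Prod.mk a ⁻¹' {z : α × β | c < F z.1 z.2}) = 0} := by
      ext a
      simp only [eLpNorm_exponent_top, Set.mem_preimage, Set.mem_Iic, Set.mem_ofPred_eq]
      constructor
      · intro h
        have := ae_le_eLpNormEssSup (f := F a) (μ := μ)
        have h2 : ∀ᵐ x ∂μ, ¬ c < F a x := by
          filter_upwards [this] with x hx
          exact not_lt.2 (hx.trans h)
        simpa [ae_iff] using h2
      · intro h
        refine essSup_le_of_ae_le _ ?_
        have h2 : ∀ᵐ x ∂μ, ¬ c < F a x := by simpa [ae_iff] using h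
        filter_upwards [h2] with x hx
        simpa using hx
    rw [this]
    exact (measurable_measure_prodMk_left (measurableSet_lt measurable_const hF)) (.singleton 0)
  · simp only [eLpNorm_eq_lintegral_rpow_enorm_toReal hq0 hq, enorm_eq_self]
    exact (Measurable.lintegral_prod_right' (f := fun z : α × β => F z.1 z.2 ^ q.toReal)
      (hF.pow_const _)).pow_const _

lemma eLpNorm_enn_mono {q : ℝ≥0∞} {f g : β → ℝ≥0∞} (h : ∀ x, f x ≤ g x) :
    eLpNorm f q μ ≤ eLpNorm g q μ :=
  eLpNorm_mono_enorm (by simpa using h)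

/-- Hölder's inequality for `F = (F N^{-1/s}) · N^{1/s}`, with `N a` the `L_r` norm of `F a` and `s`
conjugate to `r`, gives a pointwise bound whose integral over `x` collapses, as `N^r N^{-(r-1)} =
N`. No finiteness of the left side is needed beforehand. -/
lemma lintegral_rpow_lintegral_le [SFinite ν] [SFinite μ] {F : α → β → ℝ≥0∞}
    (hF : Measurable (Function.uncurry F)) {r : ℝ} (hr : 1 < r) :
    ∫⁻ x, (∫⁻ a, F a x ∂ν) ^ r ∂μ ≤ (∫⁻ a, (∫⁻ x, F a x ^ r ∂μ) ^ (1 / r) ∂ν) ^ r := by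
  have hr0 : 0 < r := by linarith
  set N : α → ℝ≥0∞ := fun a => (∫⁻ x, F a x ^ r ∂μ) ^ (1 / r) with hN
  have hFr : Measurable (fun z : α × β => F z.1 z.2 ^ r) := hF.pow_const _
  have hFa : ∀ a, Measurable fun x => F a x ^ r := fun a => hFr.comp measurable_prodMk_left
  have hNm : Measurable N := hFr.lintegral_prod_right'.pow_const _
  have hNr : ∀ a, N a ^ r = ∫⁻ x, F a x ^ r ∂μ := fun a => by
    simp only [hN]; rw [← ENNReal.rpow_mul, one_div_mul_cancel hr0.ne', ENNReal.rpow_one]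
  rcases eq_or_ne (∫⁻ a, N a ∂ν) ∞ with hΛ | hΛ
  · rw [hΛ, ENNReal.top_rpow_of_pos hr0]; exact le_top
  have hNtop : ∀ᵐ a ∂ν, N a < ∞ := ae_lt_top hNm hΛ
  -- Negative powers of `N a` are infinite where `N a = 0`; there `F a x` vanishes almost
  -- everywhere, so that the factorization stays exact.
  have hzero : ∀ᵐ x ∂μ, ∀ᵐ a ∂ν, N a = 0 → F a x = 0 := by
    rw [← Measure.ae_ae_comm (p := fun a x => N a = 0 → F a x = 0)]
    · refine Filter.Eventually.of_forall fun a => ?_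
      by_cases h : N a = 0
      · have h1 : ∫⁻ x, F a x ^ r ∂μ = 0 := by rw [← hNr, h, ENNReal.zero_rpow_of_pos hr0]
        rw [lintegral_eq_zero_iff (hFa a)] at h1
        filter_upwards [h1] with x hx _
        simpa [hr0, hr0.le, not_lt.2 hr0.le] using hx
      · simp [h]
    · have h1 : MeasurableSet {z : α × β | N z.1 = 0} :=
        (hNm.comp measurable_fst) (.singleton 0)
      have h2 : MeasurableSet {z : α × β | F z.1 z.2 = 0} := hF (.singleton 0)
      convert h1.compl.union h2 using 1
      ext z; simp [imp_iff_not_or]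
  have hconj : r.HolderConjugate (r / (r - 1)) := Real.HolderConjugate.conjExponent hr
  set s := r / (r - 1) with hs
  have hs0 : 0 < s := hconj.symm.pos
  have hrs : r / s = r - 1 := by rw [hs]; field_simp
  have key : ∀ᵐ x ∂μ, (∫⁻ a, F a x ∂ν) ^ r ≤
      (∫⁻ a, F a x ^ r * N a ^ (-(r - 1)) ∂ν) * (∫⁻ a, N a ∂ν) ^ (r - 1) := by
    filter_upwards [hzero] with x hx
    have hFx : Measurable fun a => F a x := hF.comp measurable_prodMk_right
    have h1 : ∫⁻ a, F a x ∂ν = ∫⁻ a, ((fun a => F a x * N a ^ (-(1 / s))) *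
        fun a => N a ^ (1 / s)) a ∂ν := by
      refine lintegral_congr_ae ?_
      filter_upwards [hx, hNtop] with a ha ha'
      by_cases h0 : N a = 0
      · simp [ha h0]
      · simp only [Pi.mul_apply]
        rw [mul_assoc, ← ENNReal.rpow_add _ _ h0 ha'.ne]
        simp
    have h2 := ENNReal.lintegral_mul_le_Lp_mul_Lq ν hconj
      (f := fun a => F a x * N a ^ (-(1 / s))) (g := fun a => N a ^ (1 / s))
      (hFx.mul (hNm.pow_const _)).aemeasurable (hNm.pow_const _).aemeasurable
    rw [← h1] at h2
    calc (∫⁻ a, F a x ∂ν) ^ r ≤ _ := ENNReal.rpow_le_rpow h2 hr0.le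
      _ = _ := by
        rw [ENNReal.mul_rpow_of_nonneg _ _ hr0.le, ← ENNReal.rpow_mul, one_div_mul_cancel hr0.ne',
          ENNReal.rpow_one, ← ENNReal.rpow_mul]
        congr 1
        · refine lintegral_congr fun a => ?_
          rw [ENNReal.mul_rpow_of_nonneg _ _ hr0.le, ← ENNReal.rpow_mul, ← hrs]
          congr 2; ring
        · simp only [← ENNReal.rpow_mul]
          rw [one_div_mul_cancel hs0.ne', ← hrs]
          simp only [ENNReal.rpow_one]
          congr 1; ring
  calc ∫⁻ x, (∫⁻ a, F a x ∂ν) ^ r ∂μ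
      ≤ ∫⁻ x, (∫⁻ a, F a x ^ r * N a ^ (-(r - 1)) ∂ν) * (∫⁻ a, N a ∂ν) ^ (r - 1) ∂μ :=
        lintegral_mono_ae key
    _ = (∫⁻ a, ∫⁻ x, F a x ^ r * N a ^ (-(r - 1)) ∂μ ∂ν) * (∫⁻ a, N a ∂ν) ^ (r - 1) := by
        have hm : Measurable (fun z : α × β => F z.1 z.2 ^ r * N z.1 ^ (-(r - 1))) :=
          hFr.mul ((hNm.comp measurable_fst).pow_const _)
        rw [lintegral_mul_const _ hm.lintegral_prod_left',
          lintegral_lintegral_swap (f := fun a x => F a x ^ r * N a ^ (-(r - 1))) hm.aemeasurable]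
    _ ≤ (∫⁻ a, N a ∂ν) * (∫⁻ a, N a ∂ν) ^ (r - 1) := by
        refine mul_le_mul_left (lintegral_mono_ae ?_) _
        filter_upwards [hNtop] with a ha
        rw [lintegral_mul_const _ (hFa a), ← hNr]
        by_cases h0 : N a = 0
        · rw [h0, ENNReal.zero_rpow_of_pos hr0, zero_mul]
        · rw [← ENNReal.rpow_add _ _ h0 ha.ne]
          simp
    _ = (∫⁻ a, N a ∂ν) ^ r := by
        nth_rw 1 [← ENNReal.rpow_one (∫⁻ a, N a ∂ν)]
        rw [← ENNReal.rpow_add_of_nonneg _ _ zero_le_one (by linarith)]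
        congr 1; ring

/-- **Minkowski's integral inequality.** -/
lemma eLpNorm_lintegral_le [SFinite ν] [SFinite μ] {F : α → β → ℝ≥0∞}
    (hF : Measurable (Function.uncurry F)) {q : ℝ≥0∞} (hq : 1 ≤ q) :
    eLpNorm (fun x => ∫⁻ a, F a x ∂ν) q μ ≤ ∫⁻ a, eLpNorm (F a) q μ ∂ν := by
  rcases eq_or_ne q ∞ with rfl | hqt
  · have hm := measurable_eLpNorm_param (μ := μ) hF ∞
    have h1 : ∀ᵐ x ∂μ, ∀ᵐ a ∂ν, F a x ≤ eLpNorm (F a) ∞ μ := by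
      rw [← Measure.ae_ae_comm (p := fun a x => F a x ≤ eLpNorm (F a) ∞ μ)]
      · refine Filter.Eventually.of_forall fun a => ?_
        simpa using ae_le_eLpNormEssSup (f := F a) (μ := μ)
      · exact measurableSet_le hF (hm.comp measurable_fst)
    rw [eLpNorm_exponent_top]
    refine essSup_le_of_ae_le _ ?_
    filter_upwards [h1] with x hx
    simpa using lintegral_mono_ae hx
  have hq0 : q ≠ 0 := (zero_lt_one.trans_le hq).ne'
  rcases hq.eq_or_lt with rfl | hq1
  · simp only [eLpNorm_one_eq_lintegral_enorm, enorm_eq_self]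
    exact (lintegral_lintegral_swap (f := F) hF.aemeasurable).ge
  · have hr : 1 < q.toReal := by
      rw [← ENNReal.toReal_one]; exact (ENNReal.toReal_lt_toReal (by simp) hqt).2 hq1
    simp only [eLpNorm_eq_lintegral_rpow_enorm_toReal hq0 hqt, enorm_eq_self]
    have h := ENNReal.rpow_le_rpow (lintegral_rpow_lintegral_le (ν := ν) (μ := μ) hF hr)
      (z := 1 / q.toReal) (by positivity)
    rwa [← ENNReal.rpow_mul _ q.toReal, mul_one_div_cancel (by positivity), ENNReal.rpow_one] at h

end Minkowski
end MixedNormBesov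

namespace MixedNormBesov

/-! ### Mixed quasi-norms: `t`-triangle inequalities, translations, suprema over grids -/

section MixedNorm

lemma measurable_finSnoc (n : ℕ) :
    Measurable fun z : (Fin n → ℝ) × ℝ => (Fin.snoc (α := fun _ => ℝ) z.1 z.2 : Fin (n + 1) → ℝ) := by
  refine measurable_pi_iff.2 fun i => ?_
  refine Fin.lastCases ?_ (fun j => ?_) i
  · simpa using measurable_snd
  · simpa [Function.comp_def] using (measurable_pi_apply j).comp measurable_fst

lemma measurable_mixedNormAux_param {α : Type*} [MeasurableSpace α] {n : ℕ} (p : Fin n → ℝ≥0∞)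
    {F : α → (Fin n → ℝ) → ℝ≥0∞} (hF : Measurable (Function.uncurry F)) :
    Measurable fun a => mixedNormAux n p (F a) := by
  induction n generalizing α with
  | zero => exact hF.comp measurable_prodMk_right
  | succ n ih =>
    simp only [mixedNormAux]
    refine measurable_eLpNorm_param ?_ _
    refine ih (Fin.init p) (F := fun (z : α × ℝ) (x : Fin n → ℝ) => F z.1 (Fin.snoc (α := fun _ => ℝ) x z.2)) ?_
    exact hF.comp ((measurable_fst.comp measurable_fst).prodMk
      ((measurable_finSnoc n).comp (measurable_snd.prodMk (measurable_snd.comp measurable_fst))))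

lemma measurable_mixedNormAux_snoc {n : ℕ} (p : Fin n → ℝ≥0∞)
    {f : (Fin (n + 1) → ℝ) → ℝ≥0∞} (hf : Measurable f) :
    Measurable fun t : ℝ => mixedNormAux n p fun x => f (Fin.snoc (α := fun _ => ℝ) x t) :=
  measurable_mixedNormAux_param p (F := fun (t : ℝ) x => f (Fin.snoc (α := fun _ => ℝ) x t))
    (hf.comp ((measurable_finSnoc n).comp measurable_swap))

lemma measurable_comp_finSnoc {n : ℕ} {f : (Fin (n + 1) → ℝ) → ℝ≥0∞} (hf : Measurable f) (t : ℝ) :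
    Measurable fun x : Fin n → ℝ => f (Fin.snoc (α := fun _ => ℝ) x t) :=
  hf.comp ((measurable_finSnoc n).comp measurable_prodMk_right)

lemma mixedNormAux_mono {n : ℕ} (p : Fin n → ℝ≥0∞) {f g : (Fin n → ℝ) → ℝ≥0∞}
    (h : ∀ x, f x ≤ g x) : mixedNormAux n p f ≤ mixedNormAux n p g := by
  induction n with
  | zero => exact h 0
  | succ n ih => exact eLpNorm_enn_mono fun t => ih _ fun x => h _

lemma eLpNorm_enn_const_mul_le {α : Type*} [MeasurableSpace α] {μ : Measure α} (c : ℝ≥0)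
    (f : α → ℝ≥0∞) (q : ℝ≥0∞) :
    eLpNorm (fun x => (c : ℝ≥0∞) * f x) q μ ≤ c * eLpNorm f q μ :=
  eLpNorm_le_nnreal_smul_eLpNorm_of_ae_le_mul' (Filter.Eventually.of_forall fun x => by simp) q

lemma mixedNormAux_const_mul_le {n : ℕ} (p : Fin n → ℝ≥0∞) (c : ℝ≥0) (f : (Fin n → ℝ) → ℝ≥0∞) :
    mixedNormAux n p (fun x => c * f x) ≤ c * mixedNormAux n p f := by
  induction n with
  | zero => exact le_rfl
  | succ n ih =>
    exact (eLpNorm_enn_mono fun t => ih _ _).trans (eLpNorm_enn_const_mul_le c _ _)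

/-- Minkowski's inequality applied in one variable after the other, from the innermost norm
outwards. -/
lemma mixedNormAux_lintegral_le {α : Type*} [MeasurableSpace α] {ν : Measure α} [SFinite ν] {n : ℕ}
    {p : Fin n → ℝ≥0∞} (hp : ∀ i, 1 ≤ p i) {F : α → (Fin n → ℝ) → ℝ≥0∞}
    (hF : Measurable (Function.uncurry F)) :
    mixedNormAux n p (fun x => ∫⁻ a, F a x ∂ν) ≤ ∫⁻ a, mixedNormAux n p (F a) ∂ν := by
  induction n with
  | zero => exact le_rfl
  | succ n ih =>
    have hm : Measurable fun z : (α × ℝ) × (Fin n → ℝ) =>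
        F z.1.1 (Fin.snoc (α := fun _ => ℝ) z.2 z.1.2) :=
      hF.comp ((measurable_fst.comp measurable_fst).prodMk
        ((measurable_finSnoc n).comp (measurable_snd.prodMk (measurable_snd.comp measurable_fst))))
    refine (eLpNorm_enn_mono fun t => ?_).trans (eLpNorm_lintegral_le
      (F := fun a t => mixedNormAux n (Fin.init p) fun x => F a (Fin.snoc (α := fun _ => ℝ) x t))
      ?_ (hp (Fin.last n)))
    · refine ih (fun i => hp _) (F := fun a x => F a (Fin.snoc (α := fun _ => ℝ) x t)) ?_
      have h1 : Measurable fun z : α × (Fin n → ℝ) => ((z.1, t), z.2) :=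
        (measurable_fst.prodMk measurable_const).prodMk measurable_snd
      exact hm.comp h1
    · exact measurable_mixedNormAux_param (Fin.init p)
        (F := fun (z : α × ℝ) x => F z.1 (Fin.snoc (α := fun _ => ℝ) x z.2)) hm

lemma mixedNormAux_rpow {n : ℕ} (p : Fin n → ℝ≥0∞) (f : (Fin n → ℝ) → ℝ≥0∞) {t : ℝ} (ht : 0 < t) :
    mixedNormAux n p (fun x => f x ^ t) =
      mixedNormAux n (fun i => p i * ENNReal.ofReal t) f ^ t := by
  induction n with
  | zero => rfl
  | succ n ih =>
    simp only [mixedNormAux, ih]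
    have h := eLpNorm_enorm_rpow (μ := (volume : Measure ℝ)) (p := p (Fin.last n)) (q := t)
      (fun s => mixedNormAux n (fun i => Fin.init p i * ENNReal.ofReal t)
        fun x => f (Fin.snoc (α := fun _ => ℝ) x s)) ht
    simp only [enorm_eq_self] at h
    exact h

lemma mixedNormAux_add_right {n : ℕ} (p : Fin n → ℝ≥0∞) {f : (Fin n → ℝ) → ℝ≥0∞}
    (hf : Measurable f) (z : Fin n → ℝ) :
    mixedNormAux n p (fun x => f (x + z)) = mixedNormAux n p f := by
  induction n with
  | zero => simp [mixedNormAux, Subsingleton.elim z 0]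
  | succ n ih =>
    have h : ∀ (x : Fin n → ℝ) (t : ℝ), (Fin.snoc (α := fun _ => ℝ) x t : Fin (n + 1) → ℝ) + z =
        Fin.snoc (α := fun _ => ℝ) (x + Fin.init z) (t + z (Fin.last n)) := fun x t => by
      ext i
      refine Fin.lastCases ?_ (fun j => ?_) i <;> simp [Fin.init]
    simp only [mixedNormAux, h]
    have h2 : ∀ t : ℝ, mixedNormAux n (Fin.init p) (fun x =>
        f (Fin.snoc (α := fun _ => ℝ) (x + Fin.init z) (t + z (Fin.last n)))) =
        (fun t => mixedNormAux n (Fin.init p) fun x => f (Fin.snoc (α := fun _ => ℝ) x t))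
          (t + z (Fin.last n)) := fun t =>
      ih _ (measurable_comp_finSnoc hf (t + z (Fin.last n))) (Fin.init z)
    simp only [h2]
    exact eLpNorm_comp_measurePreserving
      (measurable_mixedNormAux_snoc _ hf).aestronglyMeasurable
      (measurePreserving_add_right volume (z (Fin.last n)))

/-- The `t`-th power of the quasi-norm of `f` is the norm of `f ^ t` with exponents `p i / t ≥ 1`,
to which Minkowski's inequality applies. With counting measures it becomes the `t`-triangle
inequality for sums and series. -/
lemma mixedNormAux_rpow_le_lintegral {α : Type*} [MeasurableSpace α] {ν : Measure α} [SFinite ν]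
    {n : ℕ} {p : Fin n → ℝ≥0∞} {t : ℝ} (ht : 0 < t) (hp : ∀ i, ENNReal.ofReal t ≤ p i)
    {G : α → (Fin n → ℝ) → ℝ≥0∞} (hG : Measurable (Function.uncurry G)) {h : (Fin n → ℝ) → ℝ≥0∞}
    (hle : ∀ x, h x ^ t ≤ ∫⁻ a, G a x ^ t ∂ν) :
    mixedNormAux n p h ^ t ≤ ∫⁻ a, mixedNormAux n p (G a) ^ t ∂ν := by
  have ht0 : ENNReal.ofReal t ≠ 0 := by simpa using ht
  have hpt : (fun i => p i / ENNReal.ofReal t * ENNReal.ofReal t) = p :=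
    funext fun i => ENNReal.div_mul_cancel ht0 ENNReal.ofReal_ne_top
  have key : ∀ f : (Fin n → ℝ) → ℝ≥0∞, mixedNormAux n p f ^ t =
      mixedNormAux n (fun i => p i / ENNReal.ofReal t) fun x => f x ^ t := fun f => by
    rw [mixedNormAux_rpow _ _ ht, hpt]
  simp only [key]
  refine (mixedNormAux_mono _ hle).trans (mixedNormAux_lintegral_le (fun i => ?_)
    (F := fun a x => G a x ^ t) (hG.pow_const t))
  exact (ENNReal.le_div_iff_mul_le (Or.inl ht0) (Or.inl ENNReal.ofReal_ne_top)).2 (by simpa using hp i)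

lemma mixedNormAux_rpow_le_sum {ι : Type*} (S : Finset ι)
    {n : ℕ} {p : Fin n → ℝ≥0∞} {t : ℝ} (ht : 0 < t) (hp : ∀ i, ENNReal.ofReal t ≤ p i)
    {G : ι → (Fin n → ℝ) → ℝ≥0∞} (hG : ∀ i, Measurable (G i)) {h : (Fin n → ℝ) → ℝ≥0∞}
    (hle : ∀ x, h x ^ t ≤ ∑ i ∈ S, G i x ^ t) :
    mixedNormAux n p h ^ t ≤ ∑ i ∈ S, mixedNormAux n p (G i) ^ t := by
  let _ : MeasurableSpace S := ⊤
  have := mixedNormAux_rpow_le_lintegral (ν := (Measure.count : Measure S)) ht hp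
    (G := fun i : S => G i) (measurable_from_prod_countable_right fun i => hG i) (h := h) (by
      intro x
      rw [lintegral_count, tsum_fintype]
      rw [Finset.sum_coe_sort S (fun i => G i x ^ t)]
      exact hle x)
  rwa [lintegral_count, tsum_fintype,
    Finset.sum_coe_sort S (fun i => mixedNormAux n p (G i) ^ t)] at this

lemma mixedNormAux_rpow_le_tsum
    {n : ℕ} {p : Fin n → ℝ≥0∞} {t : ℝ} (ht : 0 < t) (hp : ∀ i, ENNReal.ofReal t ≤ p i)
    {G : ℕ → (Fin n → ℝ) → ℝ≥0∞} (hG : ∀ i, Measurable (G i)) {h : (Fin n → ℝ) → ℝ≥0∞}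
    (hle : ∀ x, h x ^ t ≤ ∑' i, G i x ^ t) :
    mixedNormAux n p h ^ t ≤ ∑' i, mixedNormAux n p (G i) ^ t := by
  have := mixedNormAux_rpow_le_lintegral (ν := (Measure.count : Measure ℕ)) ht hp
    (G := G) (measurable_from_prod_countable_right fun i => hG i) (h := h) (by
      intro x
      rw [lintegral_count]
      exact hle x)
  rwa [lintegral_count] at this

lemma exists_pos_mul_le_mixedNormAux {n : ℕ} {p : Fin n → ℝ≥0∞} (hp : ∀ i, 0 < p i) {δ : ℝ}
    (hδ : 0 < δ) : ∃ κ : ℝ≥0∞, κ ≠ 0 ∧ κ ≠ ∞ ∧ ∀ (c : ℝ≥0∞) (y : Fin n → ℝ) (f : (Fin n → ℝ) → ℝ≥0∞),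
      (∀ x, (∀ i, |x i - y i| < δ) → c ≤ f x) → c * κ ≤ mixedNormAux n p f := by
  induction n with
  | zero => exact ⟨1, by simp, by simp, fun c y f h => by simpa [mixedNormAux] using h 0 (by simp)⟩
  | succ n ih =>
    obtain ⟨κ, hκ, hκt, H⟩ := ih (p := Fin.init p) fun i => hp _
    set q := p (Fin.last n) with hq
    have hq0 : q ≠ 0 := (hp _).ne'
    -- For `q = ∞` the exponent `1 / q.toReal` is `0` and the factor is `1`, as it must be for an
    -- essential supremum.
    refine ⟨κ * ENNReal.ofReal (2 * δ) ^ (1 / q.toReal), ?_, ?_, fun c y f h => ?_⟩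
    · refine mul_ne_zero hκ ?_
      simp [ENNReal.rpow_eq_zero_iff, hδ]
    · refine ENNReal.mul_ne_top hκt (ENNReal.rpow_ne_top_of_nonneg (by positivity) ENNReal.ofReal_ne_top)
    · have hvol : volume (Metric.ball (y (Fin.last n)) δ) = ENNReal.ofReal (2 * δ) := Real.volume_ball _ _
      have h1 := eLpNorm_indicator_const' (ε := ℝ≥0∞) (μ := volume) (c := c * κ) (p := q)
        (s := Metric.ball (y (Fin.last n)) δ) measurableSet_ball
        (by rw [hvol]; simpa using hδ) hq0
      rw [hvol, enorm_eq_self, mul_assoc] at h1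
      rw [← h1]
      refine eLpNorm_enn_mono fun t => ?_
      by_cases ht : t ∈ Metric.ball (y (Fin.last n)) δ
      · rw [Set.indicator_of_mem ht]
        refine H c (Fin.init y) _ fun x hx => h _ fun i => ?_
        refine Fin.lastCases ?_ (fun j => ?_) i
        · simpa [Real.dist_eq] using ht
        · simpa [Fin.init] using hx j
      · rw [Set.indicator_of_notMem ht]; exact zero_le

/-- The supremum of a function over a finite grid in each coordinate costs the factor `N ^ (1 / t)`
in the `l`-th coordinate, where `t` is at most the first `l` exponents. -/
lemma mixedNormAux_iSup_grid_le {n : ℕ} {p : Fin n → ℝ≥0∞} (S : Fin n → Finset ℝ)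
    {t : Fin n → ℝ} (ht : ∀ l, 0 < t l) (hp : ∀ l i, i ≤ l → ENNReal.ofReal (t l) ≤ p i)
    {f : (Fin n → ℝ) → ℝ≥0∞} (hf : Measurable f) :
    mixedNormAux n p (fun x => ⨆ (k : Fin n → ℝ) (_ : ∀ i, k i ∈ S i), f (x + k)) ≤
      (∏ l, ((S l).card : ℝ≥0) ^ (1 / t l) : ℝ≥0) * mixedNormAux n p f := by
  induction n with
  | zero =>
    simp only [mixedNormAux, Finset.univ_eq_empty, Finset.prod_empty, ENNReal.coe_one, one_mul]
    exact iSup₂_le fun k _ => by rw [Subsingleton.elim (0 + k) 0]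
  | succ n ih =>
    set K : Set (Fin n → ℝ) := {k | ∀ i, k i ∈ S i.castSucc} with hK
    have hKfin : K.Finite := by
      have := Set.Finite.pi' fun i : Fin n => (S i.castSucc).finite_toSet
      simpa [hK] using this
    -- `G` is the supremum over the first `n` coordinates only. The remaining one is bounded by an
    -- `ℓ_τ` sum of translates of `G`, which all have the norm of `G`; this produces the factor
    -- `card ^ (1 / τ)`.
    set G : (Fin (n + 1) → ℝ) → ℝ≥0∞ :=
      fun y => ⨆ k ∈ K, f (y + Fin.snoc (α := fun _ => ℝ) k 0) with hG
    have hGm : Measurable G := Measurable.biSup _ hKfin.countable fun k _ =>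
      hf.comp (measurable_add_const _)
    set τ := t (Fin.last n) with hτ
    have hτ0 : 0 < τ := ht _
    have h1 := mixedNormAux_rpow_le_sum (S (Fin.last n)) (p := p) hτ0
      (fun i => hp _ i (Fin.le_last i))
      (G := fun s y => G (y + Fin.snoc (α := fun _ => ℝ) 0 s))
      (fun s => hGm.comp (measurable_add_const _))
      (h := fun x => ⨆ (k : Fin (n + 1) → ℝ) (_ : ∀ i, k i ∈ S i), f (x + k)) (fun x => by
        rw [← ENNReal.le_rpow_inv_iff hτ0]
        refine iSup₂_le fun k hk => ?_
        rw [ENNReal.le_rpow_inv_iff hτ0]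
        refine le_trans ?_ (Finset.single_le_sum (f := fun s =>
          G (x + Fin.snoc (α := fun _ => ℝ) 0 s) ^ τ) (fun _ _ => zero_le) (hk (Fin.last n)))
        refine ENNReal.rpow_le_rpow ?_ hτ0.le
        refine le_trans (le_of_eq ?_) (le_iSup₂ (f := fun k' (_ : k' ∈ K) =>
          f (x + Fin.snoc (α := fun _ => ℝ) 0 (k (Fin.last n)) + Fin.snoc (α := fun _ => ℝ) k' 0))
          (Fin.init k) (fun i => hk i.castSucc))
        congr 1
        ext i
        refine Fin.lastCases ?_ (fun j => ?_) i <;> simp [Fin.init])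
    simp only [mixedNormAux_add_right p hGm, Finset.sum_const, nsmul_eq_mul] at h1
    rw [← ENNReal.le_rpow_inv_iff hτ0, ENNReal.mul_rpow_of_nonneg _ _ (by positivity),
      ← ENNReal.rpow_mul, mul_inv_cancel₀ hτ0.ne', ENNReal.rpow_one] at h1
    refine h1.trans ?_
    -- With the last coordinate fixed, only the inner norm sees the supremum in `G`, so the last
    -- exponent does not enter here.
    have h2 : mixedNormAux (n + 1) p G ≤
        (∏ l : Fin n, ((S l.castSucc).card : ℝ≥0) ^ (1 / t l.castSucc) : ℝ≥0) *
          mixedNormAux (n + 1) p f := by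
      refine (eLpNorm_enn_mono fun s => ?_).trans (eLpNorm_enn_const_mul_le _ _ _)
      refine le_trans (le_of_eq ?_) (ih (p := Fin.init p) (fun l => S l.castSucc)
        (t := fun l => t l.castSucc) (fun l => ht _)
        (fun l i hi => hp _ _ (Fin.castSucc_le_castSucc_iff.2 hi)) (measurable_comp_finSnoc hf s))
      congr 1
      ext x
      simp only [hG, hK, Set.mem_ofPred_eq]
      congr 1; ext k; congr 1; ext _
      congr 1
      ext i
      refine Fin.lastCases ?_ (fun j => ?_) i <;> simp
    rw [Fin.prod_univ_castSucc, ENNReal.coe_mul, mul_comm (ENNReal.ofNNReal _), mul_assoc]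
    refine mul_le_mul' (le_of_eq ?_) h2
    rw [ENNReal.coe_rpow_of_nonneg _ (by have := ht (Fin.last n); positivity)]
    simp [hτ]

end MixedNorm
end MixedNormBesov

namespace MixedNormBesov

/-! ### The Peetre and Fefferman-Stein inequality for abstract weights -/

section MaximalFunction

variable {X : Type*} {b : X → X → ℝ≥0∞} {F : X → ℝ≥0∞}

lemma weight_neg_mul_le (hb1 : ∀ x y, 1 ≤ b x y) (hbt : ∀ x y, b x y ≠ ∞)
    (hb : ∀ x y z, b x z ≤ b x y * b y z) {M : ℝ} (hM : 0 ≤ M) (x y z : X) :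
    b x y ^ (-M) * b y z ^ (-M) ≤ b x z ^ (-M) := by
  have h0 : ∀ x y, b x y ≠ 0 := fun x y => (zero_lt_one.trans_le (hb1 x y)).ne'
  rw [← ENNReal.mul_rpow_of_ne_top (hbt _ _) (hbt _ _), ENNReal.rpow_neg, ENNReal.rpow_neg,
    ENNReal.inv_le_inv]
  exact ENNReal.rpow_le_rpow (hb x y z) hM

lemma weight_neg_le_one (hb1 : ∀ x y, 1 ≤ b x y) {M : ℝ} (hM : 0 ≤ M) (x y : X) :
    b x y ^ (-M) ≤ 1 := by
  rw [ENNReal.rpow_neg, ENNReal.inv_le_one]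
  exact by simpa using ENNReal.rpow_le_rpow (hb1 x y) hM

variable [MeasurableSpace X] {μ : Measure X}

/-- By submultiplicativity of `b`, `S ≤ K ∫ F b^{-M}` for the supremum `S`. Bounding the factor `(F
b^{-M})^{1-t}` of the integrand by `S^{1-t}` and cancelling it leaves the `t`-th power; the
cancellation is where `S < ∞` is indispensable. -/
lemma iSup_weight_rpow_le (hb1 : ∀ x y, 1 ≤ b x y) (hbt : ∀ x y, b x y ≠ ∞)
    (hb : ∀ x y z, b x z ≤ b x y * b y z) {M : ℝ} (hM : 0 ≤ M) {t : ℝ} (ht : 0 < t) (ht1 : t ≤ 1)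
    {K : ℝ≥0∞} (hF : ∀ y, F y ≤ K * ∫⁻ z, F z * b y z ^ (-M) ∂μ) (x : X)
    (hS : ⨆ y, F y * b x y ^ (-M) ≠ ∞) :
    (⨆ y, F y * b x y ^ (-M)) ^ t ≤ K * ∫⁻ z, F z ^ t * b x z ^ (-(M * t)) ∂μ := by
  set S := ⨆ y, F y * b x y ^ (-M) with hSdef
  have hle : ∀ y, F y * b x y ^ (-M) ≤ S := fun y => le_iSup (fun y => F y * b x y ^ (-M)) y
  have hfin : ∀ y, b x y ^ (-M) ≠ ∞ := fun y =>
    ((weight_neg_le_one hb1 hM x y).trans_lt ENNReal.one_lt_top).ne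
  have hS1 : S ^ (1 - t) ≠ ∞ := ENNReal.rpow_ne_top_of_nonneg (by linarith) hS
  have h1 : S ≤ (K * ∫⁻ z, F z ^ t * b x z ^ (-(M * t)) ∂μ) * S ^ (1 - t) := by
    refine iSup_le fun y => ?_
    calc F y * b x y ^ (-M) ≤ (K * ∫⁻ z, F z * b y z ^ (-M) ∂μ) * b x y ^ (-M) := by
          gcongr; exact hF y
      _ = K * ∫⁻ z, F z * b y z ^ (-M) * b x y ^ (-M) ∂μ := by
          rw [mul_assoc, lintegral_mul_const' _ _ (hfin y)]
      _ ≤ K * ∫⁻ z, F z ^ t * b x z ^ (-(M * t)) * S ^ (1 - t) ∂μ := by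
          refine mul_le_mul_right (lintegral_mono fun z => ?_) _
          calc F z * b y z ^ (-M) * b x y ^ (-M) ≤ F z * b x z ^ (-M) := by
                rw [mul_assoc, mul_comm (b y z ^ _)]
                gcongr
                exact weight_neg_mul_le hb1 hbt hb hM x y z
            _ = (F z * b x z ^ (-M)) ^ t * (F z * b x z ^ (-M)) ^ (1 - t) := by
                rw [← ENNReal.rpow_add_of_nonneg _ _ ht.le (by linarith)]
                simp
            _ ≤ F z ^ t * b x z ^ (-(M * t)) * S ^ (1 - t) := by
                rw [ENNReal.mul_rpow_of_nonneg _ _ ht.le, ← ENNReal.rpow_mul, neg_mul]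
                gcongr
                exact hle z
      _ = _ := by rw [lintegral_mul_const' _ _ hS1, mul_assoc]
  rcases eq_or_ne S 0 with h0 | h0
  · rw [h0, ENNReal.zero_rpow_of_pos ht]; exact zero_le
  · have h2 : S ^ t * S ^ (1 - t) ≤
        (K * ∫⁻ z, F z ^ t * b x z ^ (-(M * t)) ∂μ) * S ^ (1 - t) := by
      rw [← ENNReal.rpow_add _ _ h0 hS]
      simpa using h1
    refine (ENNReal.mul_le_mul_iff_left ?_ hS1).1 h2
    exact fun h => by
      rcases ENNReal.rpow_eq_zero_iff.1 h with h | h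
      · exact h0 h.1
      · exact hS h.1

/-- A function of polynomial growth which is dominated by its averages against arbitrarily fast
decaying weights satisfies the pointwise inequality of Peetre and Fefferman-Stein, with a constant
that only depends on one of these bounds. -/
lemma rpow_mul_weight_le_lintegral (hb1 : ∀ x y, 1 ≤ b x y) (hbb : ∀ x, b x x = 1) (hbt : ∀ x y, b x y ≠ ∞)
    (hb : ∀ x y z, b x z ≤ b x y * b y z) {t : ℝ} (ht : 0 < t) (ht1 : t ≤ 1)
    (hF : ∀ M : ℝ, 0 ≤ M → ∃ K ≠ ∞, ∀ y, F y ≤ K * ∫⁻ z, F z * b y z ^ (-M) ∂μ)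
    {A : ℝ≥0∞} (hA : A ≠ ∞) (o : X) {N : ℝ} (hN : 0 ≤ N) (hgrowth : ∀ y, F y ≤ A * b o y ^ N)
    {M₀ : ℝ} (hM₀ : 0 ≤ M₀) {K₀ : ℝ≥0∞}
    (hF₀ : ∀ y, F y ≤ K₀ * ∫⁻ z, F z * b y z ^ (-M₀) ∂μ) (x y : X) :
    F y ^ t * b x y ^ (-(M₀ * t)) ≤ K₀ * ∫⁻ z, F z ^ t * b x z ^ (-(M₀ * t)) ∂μ := by
  set I : X → ℝ≥0∞ := fun x => ∫⁻ z, F z ^ t * b x z ^ (-(M₀ * t)) ∂μ with hI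
  have h0 : ∀ x y, b x y ≠ 0 := fun x y => (zero_lt_one.trans_le (hb1 x y)).ne'
  rcases eq_or_ne K₀ 0 with rfl | hK₀
  · have : F y = 0 := by simpa using hF₀ y
    simp [this, ht]
  rcases eq_or_ne (I x) ∞ with hIx | hIx
  · change _ ≤ K₀ * I x
    rw [hIx, ENNReal.mul_top hK₀]; exact le_top
  -- Bootstrap: a weight exponent beyond the growth order `N` makes the supremum finite, at the
  -- price of an uncontrolled constant `K`. The resulting bound shows that the supremum with
  -- exponent `M₀` is finite too, and a second application then yields the constant `K₀`.
  set M := max M₀ N with hM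
  have hM0 : 0 ≤ M := hM₀.trans (le_max_left _ _)
  obtain ⟨K, hK, hFK⟩ := hF M hM0
  have hSfin : ∀ w, ⨆ y, F y * b w y ^ (-M) ≠ ∞ := fun w => by
    refine ((iSup_le fun y => ?_).trans_lt
      (ENNReal.mul_lt_top hA.lt_top (ENNReal.rpow_lt_top_of_nonneg hN (hbt o w)))).ne
    calc F y * b w y ^ (-M) ≤ (A * b o y ^ N) * b w y ^ (-N) := by
          gcongr
          · exact hgrowth y
          · exact hb1 w y
          · exact le_max_right _ _
      _ ≤ (A * (b o w * b w y) ^ N) * b w y ^ (-N) := by gcongr; exact hb o w y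
      _ = A * b o w ^ N * (b w y ^ N * b w y ^ (-N)) := by
          rw [ENNReal.mul_rpow_of_nonneg _ _ hN]; ring
      _ = A * b o w ^ N := by
          rw [← ENNReal.rpow_add _ _ (h0 _ _) (hbt _ _)]; simp
  have hstep : ∀ w, F w ^ t ≤ K * I w := fun w => by
    have h1 := iSup_weight_rpow_le hb1 hbt hb hM0 ht ht1 hFK w (hSfin w)
    have h2 : F w ≤ ⨆ y, F y * b w y ^ (-M) := by
      simpa [hbb] using le_iSup (fun y => F y * b w y ^ (-M)) w
    refine (ENNReal.rpow_le_rpow h2 ht.le).trans (h1.trans ?_)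
    refine mul_le_mul_right (lintegral_mono fun z => ?_) _
    gcongr
    · exact hb1 w z
    · exact le_max_left _ _
  have hMt : 0 ≤ M₀ * t := by positivity
  have hle : ∀ y, (F y * b x y ^ (-M₀)) ^ t ≤ K * I x := fun y => by
    rw [ENNReal.mul_rpow_of_nonneg _ _ ht.le, ← ENNReal.rpow_mul, neg_mul]
    calc F y ^ t * b x y ^ (-(M₀ * t)) ≤ K * I y * b x y ^ (-(M₀ * t)) := by
          gcongr; exact hstep y
      _ = K * ∫⁻ z, F z ^ t * b y z ^ (-(M₀ * t)) * b x y ^ (-(M₀ * t)) ∂μ := by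
          rw [mul_assoc, lintegral_mul_const' _ _
            ((weight_neg_le_one hb1 hMt x y).trans_lt ENNReal.one_lt_top).ne]
      _ ≤ K * I x := by
          refine mul_le_mul_right (lintegral_mono fun z => ?_) _
          rw [mul_assoc, mul_comm (b y z ^ _)]
          gcongr
          exact weight_neg_mul_le hb1 hbt hb hMt x y z
  have hS₀ : ⨆ y, F y * b x y ^ (-M₀) ≠ ∞ := by
    refine ((iSup_le fun y => (ENNReal.le_rpow_inv_iff ht).2 (hle y)).trans_lt
      (ENNReal.rpow_lt_top_of_nonneg (by positivity) (ENNReal.mul_ne_top hK hIx))).ne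
  refine le_trans ?_ (iSup_weight_rpow_le hb1 hbt hb hM₀ ht ht1 hF₀ x hS₀)
  rw [← neg_mul, ENNReal.rpow_mul, ← ENNReal.mul_rpow_of_nonneg _ _ ht.le]
  exact ENNReal.rpow_le_rpow (le_iSup (fun y => F y * b x y ^ (-M₀)) y) ht.le

end MaximalFunction
end MixedNormBesov

namespace MixedNormBesov

/-! ### Schwartz functions: multiplication by dilates, growth of convolutions, Fourier transforms -/

section Schwartz

open Filter Topology FourierTransform

variable {E : Type*} [NormedAddCommGroup E]

section Dilation

variable [NormedSpace ℝ E]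

/-- For `i = 0` this is the mean value inequality, whence the factor `‖x‖`; for `i ≥ 1` the chain
rule gives `‖A‖ ^ i ≤ ‖A‖`. -/
lemma norm_iteratedFDeriv_comp_sub_apply_zero_le (η : 𝓢(E, ℂ)) (i : ℕ) :
    ∃ C : ℝ, 0 ≤ C ∧ ∀ (A : E →L[ℝ] E), ‖A‖ ≤ 1 → ∀ x,
      ‖iteratedFDeriv ℝ i (fun x => η (A x) - η 0) x‖ ≤ C * ‖A‖ * (1 + ‖x‖) := by
  rcases Nat.eq_zero_or_pos i with rfl | hi
  · refine ⟨SchwartzMap.seminorm ℝ 0 1 η, apply_nonneg _ _, fun A _ x => ?_⟩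
    rw [norm_iteratedFDeriv_zero]
    have h1 : ‖η (A x) - η 0‖ ≤ SchwartzMap.seminorm ℝ 0 1 η * ‖A x - 0‖ := by
      refine convex_univ.norm_image_sub_le_of_norm_fderiv_le (𝕜 := ℝ)
        (fun y _ => η.differentiableAt) (fun y _ => ?_) (Set.mem_univ _) (Set.mem_univ _)
      have := SchwartzMap.norm_iteratedFDeriv_le_seminorm ℝ (n := 1) η y
      rwa [norm_iteratedFDeriv_one] at this
    refine h1.trans ?_
    rw [sub_zero, mul_assoc]
    gcongr
    refine (A.le_opNorm x).trans ?_
    gcongr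
    linarith
  · refine ⟨SchwartzMap.seminorm ℝ 0 i η, apply_nonneg _ _, fun A hA x => ?_⟩
    have hη : ContDiff ℝ i η := η.smooth i
    have h1 : iteratedFDeriv ℝ i (fun x => η (A x) - η 0) x =
        (iteratedFDeriv ℝ i η (A x)).compContinuousLinearMap fun _ => A := by
      rw [← A.iteratedFDeriv_comp_right hη x le_rfl]
      change iteratedFDeriv ℝ i ((η ∘ A) - fun _ => η 0) x = _
      rw [iteratedFDeriv_sub_apply (hη.comp A.contDiff).contDiffAt contDiffAt_const,
        iteratedFDeriv_const_of_ne hi.ne']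
      simp
    rw [h1]
    refine (ContinuousMultilinearMap.norm_compContinuousLinearMap_le _ _).trans ?_
    have h2 := SchwartzMap.norm_iteratedFDeriv_le_seminorm ℝ (n := i) η (A x)
    have h3 : ∏ _j : Fin i, ‖A‖ ≤ ‖A‖ := by
      rw [Finset.prod_const, Finset.card_univ, Fintype.card_fin]
      exact pow_le_of_le_one (norm_nonneg _) hA hi.ne'
    calc _ ≤ SchwartzMap.seminorm ℝ 0 i η * ‖A‖ := by gcongr
      _ ≤ _ := le_mul_of_one_le_right (by positivity) (by linarith [norm_nonneg x])

lemma hasTemperateGrowth_comp_clm (η : 𝓢(E, ℂ)) (A : E →L[ℝ] E) :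
    (fun x => η (A x)).HasTemperateGrowth :=
  η.hasTemperateGrowth.comp A.hasTemperateGrowth

/-- Multiplication by dilates `η (A x)` with `A → 0` converges to multiplication by `η 0`. -/
lemma tendsto_smulLeftCLM_comp (η χ : 𝓢(E, ℂ)) {A : ℕ → E →L[ℝ] E}
    (hA : Tendsto (fun k => ‖A k‖) atTop (𝓝 0)) :
    Tendsto (fun k => SchwartzMap.smulLeftCLM ℂ (fun x => η (A k x)) χ) atTop (𝓝 (η 0 • χ)) := by
  rw [(schwartz_withSeminorms ℝ E ℂ).tendsto_nhds]
  rintro ⟨k, n⟩ ε hε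
  choose C hC0 hC using norm_iteratedFDeriv_comp_sub_apply_zero_le η
  -- The growth factor `1 + ‖x‖` is absorbed by one more power of decay of `χ`, hence the seminorm
  -- of order `k + 1`.
  set B : ℝ := ∑ i ∈ Finset.range (n + 1), (n.choose i : ℝ) * C i *
    (SchwartzMap.seminorm ℝ k (n - i) χ + SchwartzMap.seminorm ℝ (k + 1) (n - i) χ) with hB
  have hB0 : 0 ≤ B := Finset.sum_nonneg fun i _ => by have := hC0 i; positivity
  have key : ∀ T : E →L[ℝ] E, ‖T‖ ≤ 1 → SchwartzMap.seminorm ℝ k n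
      (SchwartzMap.smulLeftCLM ℂ (fun x => η (T x)) χ - η 0 • χ) ≤ B * ‖T‖ := by
    intro T hT
    refine SchwartzMap.seminorm_le_bound ℝ k n _ (by positivity) fun x => ?_
    have hcoe : (⇑(SchwartzMap.smulLeftCLM ℂ (fun x => η (T x)) χ - η 0 • χ) : E → ℂ) =
        fun x => (η (T x) - η 0) * χ x := by
      ext x
      simp [SchwartzMap.smulLeftCLM_apply_apply (hasTemperateGrowth_comp_clm η T), sub_mul]
    rw [hcoe]
    have hη : ContDiff ℝ n fun x => η (T x) - η 0 :=
      ((η.smooth n).comp T.contDiff).sub contDiff_const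
    calc ‖x‖ ^ k * _ ≤ ‖x‖ ^ k * _ :=
          mul_le_mul_of_nonneg_left (norm_iteratedFDeriv_mul_le hη (χ.smooth n) x le_rfl)
            (by positivity)
      _ = ∑ i ∈ Finset.range (n + 1), ‖x‖ ^ k * ((n.choose i : ℝ) *
            ‖iteratedFDeriv ℝ i (fun x => η (T x) - η 0) x‖ * ‖iteratedFDeriv ℝ (n - i) χ x‖) :=
          Finset.mul_sum _ _ _
      _ ≤ ∑ i ∈ Finset.range (n + 1), (n.choose i : ℝ) * C i *
            (SchwartzMap.seminorm ℝ k (n - i) χ + SchwartzMap.seminorm ℝ (k + 1) (n - i) χ) *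
              ‖T‖ := by
          refine Finset.sum_le_sum fun i _ => ?_
          have h1 := SchwartzMap.le_seminorm ℝ k (n - i) χ x
          have h2 := SchwartzMap.le_seminorm ℝ (k + 1) (n - i) χ x
          have h3 := hC i T hT x
          have h0 := hC0 i
          calc _ ≤ ‖x‖ ^ k * ((n.choose i : ℝ) * (C i * ‖T‖ * (1 + ‖x‖)) *
                ‖iteratedFDeriv ℝ (n - i) χ x‖) := by gcongr
            _ = (n.choose i : ℝ) * C i * (‖x‖ ^ k * ‖iteratedFDeriv ℝ (n - i) χ x‖ +
                ‖x‖ ^ (k + 1) * ‖iteratedFDeriv ℝ (n - i) χ x‖) * ‖T‖ := by ring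
            _ ≤ _ := by gcongr
      _ = B * ‖T‖ := by rw [hB, Finset.sum_mul]
  have hlim : Tendsto (fun j => B * ‖A j‖) atTop (𝓝 0) := by simpa using hA.const_mul B
  filter_upwards [hlim.eventually (gt_mem_nhds hε), hA.eventually (gt_mem_nhds one_pos)]
    with j h1 h2
  exact (key (A j) h2.le).trans_lt h1

/-- Continuity of `v` means a bound by finitely many seminorms, and each of them grows polynomially
under translation. This supplies the a priori growth on which the maximal inequality depends. -/
lemma exists_norm_apply_compSubConst_le (v : 𝓢'(E, ℂ)) (g : 𝓢(E, ℂ)) :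
    ∃ (A : ℝ) (N : ℕ), 0 ≤ A ∧ ∀ y, ‖v (g.compSubConstCLM ℂ y)‖ ≤ A * (1 + ‖y‖) ^ N := by
  obtain ⟨s, C, -, hC⟩ := Seminorm.bound_of_continuous (schwartz_withSeminorms ℂ E ℂ)
    ((normSeminorm ℂ ℂ).comp v.toLinearMap) (continuous_norm.comp v.continuous)
  have h1 : ∀ m : ℕ × ℕ, ∃ B : ℝ, 0 ≤ B ∧ ∀ y, SchwartzMap.seminorm ℂ m.1 m.2
      (g.compSubConstCLM ℂ y) ≤ B * (1 + ‖y‖) ^ m.1 := fun m => by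
    set B := 2 ^ m.1 * (Finset.Iic m).sup (fun m => SchwartzMap.seminorm ℂ m.1 m.2) g with hB
    have hB0 : 0 ≤ B := by positivity
    refine ⟨B, hB0, fun y => SchwartzMap.seminorm_le_bound ℂ _ _ _ (by positivity) fun x => ?_⟩
    have h2 : iteratedFDeriv ℝ m.2 (g.compSubConstCLM ℂ y) x = iteratedFDeriv ℝ m.2 g (x - y) :=
      iteratedFDeriv_comp_sub m.2 y x
    have h3 : ‖x‖ ≤ (1 + ‖y‖) * (1 + ‖x - y‖) := by
      have := norm_add_le (x - y) y
      rw [sub_add_cancel] at this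
      nlinarith [norm_nonneg (x - y), norm_nonneg y]
    rw [h2]
    calc _ ≤ ((1 + ‖y‖) * (1 + ‖x - y‖)) ^ m.1 * ‖iteratedFDeriv ℝ m.2 g (x - y)‖ := by gcongr
      _ = ((1 + ‖x - y‖) ^ m.1 * ‖iteratedFDeriv ℝ m.2 g (x - y)‖) * (1 + ‖y‖) ^ m.1 := by
          rw [mul_pow]; ring
      _ ≤ B * (1 + ‖y‖) ^ m.1 := by
          gcongr
          exact SchwartzMap.one_add_le_sup_seminorm_apply (𝕜 := ℂ) le_rfl le_rfl g (x - y)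
  choose B hB0 hB using h1
  refine ⟨C * ∑ m ∈ s, B m, ∑ m ∈ s, m.1, by
    have := Finset.sum_nonneg (s := s) fun m _ => hB0 m
    positivity, fun y => ?_⟩
  calc ‖v (g.compSubConstCLM ℂ y)‖
      ≤ C * (s.sup (schwartzSeminormFamily ℂ E ℂ)) (g.compSubConstCLM ℂ y) := hC _
    _ ≤ C * ∑ m ∈ s, B m * (1 + ‖y‖) ^ ∑ m ∈ s, m.1 := by
        gcongr
        refine (Seminorm.finset_sup_le_sum _ s _).trans ?_
        rw [_root_.sum_apply]
        refine Finset.sum_le_sum fun m hm => (hB m y).trans ?_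
        have := hB0 m
        gcongr
        · linarith [norm_nonneg y]
        · exact Finset.single_le_sum (f := fun m : ℕ × ℕ => m.1) (fun _ _ => Nat.zero_le _) hm
    _ = _ := by rw [Finset.mul_sum, Finset.mul_sum, Finset.sum_mul]; simp only [mul_assoc]

end Dilation

section Fourier

variable [InnerProductSpace ℝ E] [FiniteDimensional ℝ E] [MeasurableSpace E] [BorelSpace E]

lemma fourierInv_compSubConst_apply (g : 𝓢(E, ℂ)) (y ξ : E) :
    𝓕⁻ (g.compSubConstCLM ℂ y) ξ = Real.fourierChar (inner ℝ y ξ) * 𝓕⁻ g ξ := by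
  rw [SchwartzMap.fourierInv_coe, SchwartzMap.fourierInv_coe, Real.fourierInv_eq,
    Real.fourierInv_eq, ← integral_add_right_eq_self _ y, ← integral_const_mul]
  refine integral_congr_ae (Eventually.of_forall fun x => ?_)
  simp [inner_add_left, AddChar.map_add_eq_mul, Circle.smul_def]
  ring

lemma fourierInv_compEquiv_smul_apply (ρ : 𝓢(E, ℂ)) {R : ℝ} (hR : 0 < R)
    (ρR : 𝓢(E, ℂ)) (h : ∀ x, ρR x = (R : ℂ) ^ (Module.finrank ℝ E) * ρ (R • x)) (ξ : E) :
    𝓕⁻ ρR ξ = 𝓕⁻ ρ (R⁻¹ • ξ) := by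
  rw [SchwartzMap.fourierInv_coe, SchwartzMap.fourierInv_coe, Real.fourierInv_eq,
    Real.fourierInv_eq]
  have h1 := Measure.integral_comp_smul (volume : Measure E)
    (fun v => Real.fourierChar (inner ℝ v (R⁻¹ • ξ)) • ρ v) R
  have h2 : ∀ v : E, Real.fourierChar (inner ℝ v ξ) • ρR v = (R : ℂ) ^ (Module.finrank ℝ E) *
      (Real.fourierChar (inner ℝ (R • v) (R⁻¹ • ξ)) • ρ (R • v)) := fun v => by
    rw [h, inner_smul_left, inner_smul_right]
    simp [hR.ne', Circle.smul_def]
    ring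
  simp only [h2]
  rw [integral_const_mul, h1, Complex.real_smul, ← mul_assoc, abs_of_pos (by positivity)]
  push_cast
  rw [mul_inv_cancel₀ (by exact_mod_cast (pow_pos hR _).ne'), one_mul]

end Fourier
end Schwartz
end MixedNormBesov

namespace MixedNormBesov

/-! ### Band-limited functions: reproducing formula and uniform maximal inequality -/

section BandLimited

open Filter Topology FourierTransform

variable {E : Type*} [NormedAddCommGroup E] [InnerProductSpace ℝ E] [FiniteDimensional ℝ E]
  [MeasurableSpace E] [BorelSpace E]

/-- The distribution `v` is the function `f`. -/
def Represents (v : 𝓢'(E, ℂ)) (f : E → ℂ) : Prop :=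
  ∀ φ : 𝓢(E, ℂ), Integrable (fun x => φ x * f x) ∧ v φ = ∫ x, φ x * f x

/-- The dilates `R ^ n ρ (R (x - y))` of a Schwartz function. -/
noncomputable def dilatedBump (ρ : 𝓢(E, ℂ)) (R : ℝ) (hR : R ≠ 0) (y : E) : 𝓢(E, ℂ) :=
  ((R : ℂ) ^ Module.finrank ℝ E • SchwartzMap.compCLMOfContinuousLinearEquiv ℂ
    (ContinuousLinearEquiv.smulLeft (Units.mk0 R hR)) ρ).compSubConstCLM ℂ y

omit [FiniteDimensional ℝ E] [MeasurableSpace E] [BorelSpace E] in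
lemma dilatedBump_apply (ρ : 𝓢(E, ℂ)) (R : ℝ) (hR : R ≠ 0) (y x : E) :
    dilatedBump ρ R hR y x = (R : ℂ) ^ Module.finrank ℝ E * ρ (R • (x - y)) := rfl

lemma fourierInv_dilatedBump (ρ : 𝓢(E, ℂ)) {R : ℝ} (hR : 0 < R) (y ξ : E) :
    𝓕⁻ (dilatedBump ρ R hR.ne' y) ξ = Real.fourierChar (inner ℝ y ξ) * 𝓕⁻ ρ (R⁻¹ • ξ) := by
  rw [dilatedBump, fourierInv_compSubConst_apply, fourierInv_compEquiv_smul_apply ρ hR]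
  exact fun x => rfl

lemma integral_dilatedBump_mul (ρ : 𝓢(E, ℂ)) {R : ℝ} (hR : 0 < R) (y : E) (f : E → ℂ) :
    ∫ x, dilatedBump ρ R hR.ne' y x * f x = ∫ x, ρ x * f (y + R⁻¹ • x) := by
  have h1 := Measure.integral_comp_smul (volume : Measure E)
    (fun x => ρ x * f (y + R⁻¹ • x)) R
  rw [← integral_add_right_eq_self _ y]
  simp only [dilatedBump_apply, add_sub_cancel_right, mul_assoc]
  rw [integral_const_mul]
  have h2 : ∀ x : E, ρ (R • x) * f (x + y) = ρ (R • x) * f (y + R⁻¹ • R • x) := fun x => by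
    rw [inv_smul_smul₀ hR.ne', add_comm]
  simp only [h2]
  rw [h1, Complex.real_smul, ← mul_assoc, abs_of_pos (by positivity)]
  push_cast
  rw [mul_inv_cancel₀ (by exact_mod_cast (pow_pos hR _).ne'), one_mul]

/-- Compact support of `ρ` lets continuity of `f` suffice; no growth bound on `f` is available at
this stage. -/
lemma tendsto_integral_bump_mul {ρ : 𝓢(E, ℂ)} (hρ : HasCompactSupport ρ) {f : E → ℂ}
    (hf : Continuous f) (y : E) {s : ℕ → ℝ} (hs : Tendsto s atTop (𝓝 0)) :
    Tendsto (fun k => ∫ x, ρ x * f (y + s k • x)) atTop (𝓝 ((∫ x, ρ x) * f y)) := by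
  have h1 : ∀ r : ℝ, ∫ x in tsupport ρ, ρ x * f (y + r • x) = ∫ x, ρ x * f (y + r • x) := fun r =>
    setIntegral_eq_integral_of_forall_compl_eq_zero fun x hx => by
      rw [image_eq_zero_of_notMem_tsupport hx, zero_mul]
  have h2 : Continuous fun r : ℝ => ∫ x in tsupport ρ, ρ x * f (y + r • x) := by
    refine continuous_parametric_integral_of_continuous (μ := volume) ?_ hρ
    have := ρ.continuous
    simp only [Function.uncurry_def]
    fun_prop
  simp only [h1] at h2
  have h3 := (h2.tendsto 0).comp hs
  simpa [Function.comp_def, integral_mul_const] using h3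

lemma exists_bump (E : Type*) [NormedAddCommGroup E] [InnerProductSpace ℝ E]
    [FiniteDimensional ℝ E] [MeasurableSpace E] [BorelSpace E] :
    ∃ ρ : 𝓢(E, ℂ), HasCompactSupport ρ ∧ ∫ x, ρ x = 1 := by
  let φ : ContDiffBump (0 : E) := ⟨1, 2, one_pos, one_lt_two⟩
  have h1 : HasCompactSupport fun x => ((φ.normed volume x : ℝ) : ℂ) :=
    φ.hasCompactSupport_normed.comp_left (g := fun r : ℝ => (r : ℂ)) (by simp)
  refine ⟨h1.toSchwartzMap (Complex.ofRealCLM.contDiff.comp φ.contDiff_normed), h1, ?_⟩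
  change ∫ x, ((φ.normed volume x : ℝ) : ℂ) = 1
  rw [integral_complex_ofReal, φ.integral_normed]
  simp

/-- A band-limited function is reproduced by convolution. -/
lemma eq_apply_compSubConst {v : 𝓢'(E, ℂ)} {f : E → ℂ} (hf : Continuous f) (hv : Represents v f)
    {χ : 𝓢(E, ℂ)} (hχ : TemperedDistribution.fourierMultiplierCLM ℂ χ v = v) (y : E) :
    f y = v ((𝓕 χ).compSubConstCLM ℂ y) := by
  obtain ⟨ρ, hρ, hρ1⟩ := exists_bump E
  have hR : ∀ k : ℕ, (0 : ℝ) < k + 1 := fun k => by positivity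
  have hs : Tendsto (fun k : ℕ => ((k : ℝ) + 1)⁻¹) atTop (𝓝 0) := by
    simpa using tendsto_one_div_add_atTop_nhds_zero_nat (𝕜 := ℝ)
  have h1 := tendsto_integral_bump_mul hρ hf y hs
  rw [hρ1, one_mul] at h1
  refine tendsto_nhds_unique h1 ?_
  -- This is `χ` times the character of `y`. Since `χ` reproduces `v`, testing `v` with an
  -- approximate delta at `y` amounts to testing it with the Fourier transform of `χy` times a
  -- dilate of `𝓕⁻ ρ`; these products tend to `χy` in `𝓢` because `∫ ρ = 1`.
  set χy : 𝓢(E, ℂ) := 𝓕⁻ ((𝓕 χ).compSubConstCLM ℂ y) with hχy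
  let A : ℕ → E →L[ℝ] E := fun k => ((k : ℝ) + 1)⁻¹ • ContinuousLinearMap.id ℝ E
  have hA : Tendsto (fun k => ‖A k‖) atTop (𝓝 0) := by
    refine squeeze_zero (fun _ => norm_nonneg _) (fun k => ?_) hs
    rw [norm_smul, Real.norm_of_nonneg (inv_nonneg.2 (hR k).le)]
    exact mul_le_of_le_one_right (inv_nonneg.2 (hR k).le) ContinuousLinearMap.norm_id_le
  have h2 := tendsto_smulLeftCLM_comp (𝓕⁻ ρ) χy hA
  have h3 : (𝓕⁻ ρ : 𝓢(E, ℂ)) 0 = 1 := by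
    rw [SchwartzMap.fourierInv_coe, Real.fourierInv_eq]
    simpa using hρ1
  rw [h3, one_smul] at h2
  have h4 := ((v.continuous.comp (SchwartzMap.fourierTransformCLM (E := ℂ) (V := E) ℂ).continuous).tendsto
    χy).comp h2
  have h5 : (𝓕 χy : 𝓢(E, ℂ)) = (𝓕 χ).compSubConstCLM ℂ y := by
    rw [hχy, FourierTransform.fourier_fourierInv_eq]
  rw [← h5]
  refine h4.congr fun k => ?_
  rw [← integral_dilatedBump_mul ρ (hR k) y f, ← (hv _).2]
  nth_rw 2 [← hχ]
  rw [TemperedDistribution.fourierMultiplierCLM_apply_apply]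
  simp only [Function.comp_apply]
  congr 2
  ext ξ
  rw [SchwartzMap.smulLeftCLM_apply_apply (hasTemperateGrowth_comp_clm _ _),
    SchwartzMap.smulLeftCLM_apply_apply χ.hasTemperateGrowth, fourierInv_dilatedBump ρ (hR k), hχy,
    fourierInv_compSubConst_apply, FourierTransform.fourierInv_fourier_eq]
  simp only [A, smul_eq_mul, smul_apply, ContinuousLinearMap.id_apply]
  ring

/-- Change of variables, with `D` moved to the other side of the inner product. The determinant is
the density of `dilMeasure D`, so kernel bounds in terms of `dilWeight D` hold with constants
independent of `D`. -/
lemma fourier_comp_symm_apply (χ : 𝓢(E, ℂ)) (D : E ≃L[ℝ] E)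
    (hD : ∀ x y, inner ℝ (D x) y = inner ℝ x (D y)) (x : E) :
    𝓕 (SchwartzMap.compCLMOfContinuousLinearEquiv ℂ D.symm χ) x =
      |LinearMap.det ((D : E →L[ℝ] E) : E →ₗ[ℝ] E)| * 𝓕 χ (D x) := by
  have hdet : LinearMap.det ((D : E →L[ℝ] E) : E →ₗ[ℝ] E) ≠ 0 :=
    (LinearEquiv.isUnit_det' D.toLinearEquiv).ne_zero
  have hmap := Measure.map_linearMap_addHaar_eq_smul_addHaar (volume : Measure E) hdet
  rw [SchwartzMap.fourier_coe, SchwartzMap.fourier_coe, Real.fourier_eq, Real.fourier_eq]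
  have h1 : ∫ v, Real.fourierChar (-inner ℝ v x) • χ (D.symm v) ∂(Measure.map D volume) =
      ∫ v, Real.fourierChar (-inner ℝ v (D x)) • χ v := by
    refine (D.toHomeomorph.measurableEmbedding.integral_map _).trans ?_
    simp [hD]
  rw [← h1]
  have h2 : Measure.map D (volume : Measure E) = _ := hmap
  rw [h2, integral_smul_measure, ENNReal.toReal_ofReal (abs_nonneg _), abs_inv, Complex.real_smul,
    ← mul_assoc]
  push_cast
  rw [mul_inv_cancel₀ (by simpa using hdet), one_mul]
  rfl

omit [FiniteDimensional ℝ E] [MeasurableSpace E] [BorelSpace E] in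
lemma exists_enorm_le_weight (g : 𝓢(E, ℂ)) (M : ℝ) :
    ∃ K : ℝ≥0, ∀ x, ‖g x‖ₑ ≤ K * ENNReal.ofReal (1 + ‖x‖) ^ (-M) := by
  obtain ⟨B, hB⟩ : ∃ B : ℝ≥0, ∀ x, (1 + ‖x‖) ^ ⌈M⌉₊ * ‖g x‖ ≤ B := by
    refine ⟨⟨2 ^ ⌈M⌉₊ * (Finset.Iic (⌈M⌉₊, 0)).sup
      (fun m => SchwartzMap.seminorm ℝ m.1 m.2) g, by positivity⟩, fun x => ?_⟩
    have := SchwartzMap.one_add_le_sup_seminorm_apply (𝕜 := ℝ) (m := (⌈M⌉₊, 0)) le_rfl le_rfl g x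
    rwa [norm_iteratedFDeriv_zero] at this
  refine ⟨B, fun x => ?_⟩
  have hpos : 0 < 1 + ‖x‖ := by positivity
  have h0 : ENNReal.ofReal (1 + ‖x‖) ^ M ≠ 0 := by
    rw [ENNReal.ofReal_rpow_of_pos hpos]; simpa using Real.rpow_pos_of_pos hpos M
  have ht : ENNReal.ofReal (1 + ‖x‖) ^ M ≠ ∞ := by
    rw [ENNReal.ofReal_rpow_of_pos hpos]; exact ENNReal.ofReal_ne_top
  rw [ENNReal.rpow_neg, ← div_eq_mul_inv, ENNReal.le_div_iff_mul_le (Or.inl h0) (Or.inl ht),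
    ENNReal.ofReal_rpow_of_pos hpos, ← ofReal_norm, ← ENNReal.ofReal_mul (norm_nonneg _),
    ← ENNReal.ofReal_coe_nnreal]
  refine ENNReal.ofReal_le_ofReal (le_trans ?_ (hB x))
  rw [mul_comm]
  gcongr
  rw [← Real.rpow_natCast]
  exact Real.rpow_le_rpow_of_exponent_le (by linarith [norm_nonneg x]) (Nat.le_ceil M)

/-- The quasi-homogeneous weight `1 + |D (x - y)|`. -/
noncomputable def dilWeight (D : E ≃L[ℝ] E) (x y : E) : ℝ≥0∞ := ENNReal.ofReal (1 + ‖D (x - y)‖)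

/-- Lebesgue measure in the coordinates `D x`. -/
noncomputable def dilMeasure (D : E ≃L[ℝ] E) : Measure E :=
  ENNReal.ofReal |LinearMap.det ((D : E →L[ℝ] E) : E →ₗ[ℝ] E)| • volume

instance (D : E ≃L[ℝ] E) : SFinite (dilMeasure D) := by
  unfold dilMeasure; infer_instance

instance (D : E ≃L[ℝ] E) : (dilMeasure D).IsAddLeftInvariant := by
  unfold dilMeasure; infer_instance

lemma lintegral_dilMeasure (D : E ≃L[ℝ] E) (g : E → ℝ≥0∞) :
    ∫⁻ z, g (D z) ∂dilMeasure D = ∫⁻ z, g z := by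
  have hdet : LinearMap.det ((D : E →L[ℝ] E) : E →ₗ[ℝ] E) ≠ 0 :=
    (LinearEquiv.isUnit_det' D.toLinearEquiv).ne_zero
  have h1 : ∫⁻ z, g z ∂(Measure.map D volume) = ∫⁻ z, g (D z) :=
    D.toHomeomorph.measurableEmbedding.lintegral_map g
  have h2 : Measure.map D (volume : Measure E) =
      ENNReal.ofReal |(LinearMap.det ((D : E →L[ℝ] E) : E →ₗ[ℝ] E))⁻¹| • volume :=
    Measure.map_linearMap_addHaar_eq_smul_addHaar (volume : Measure E) hdet
  rw [dilMeasure, lintegral_smul_measure, ← h1, h2, lintegral_smul_measure, smul_eq_mul,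
    smul_eq_mul, ← mul_assoc, ← ENNReal.ofReal_mul (abs_nonneg _), ← abs_mul,
    mul_inv_cancel₀ hdet]
  simp

omit [FiniteDimensional ℝ E] [MeasurableSpace E] [BorelSpace E] in
lemma one_le_dilWeight (D : E ≃L[ℝ] E) (x y : E) : 1 ≤ dilWeight D x y := by
  rw [dilWeight, ENNReal.one_le_ofReal]; linarith [norm_nonneg (D (x - y))]

omit [FiniteDimensional ℝ E] [MeasurableSpace E] [BorelSpace E] in
lemma dilWeight_triangle (D : E ≃L[ℝ] E) (x y z : E) :
    dilWeight D x z ≤ dilWeight D x y * dilWeight D y z := by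
  rw [dilWeight, dilWeight, dilWeight, ← ENNReal.ofReal_mul (by positivity)]
  refine ENNReal.ofReal_le_ofReal ?_
  have : D (x - z) = D (x - y) + D (y - z) := by rw [← map_add]; congr 1; abel
  rw [this]
  nlinarith [norm_add_le (D (x - y)) (D (y - z)), norm_nonneg (D (x - y)), norm_nonneg (D (y - z))]

lemma lintegral_dilWeight (D : E ≃L[ℝ] E) (x : E) (m : ℝ) :
    ∫⁻ z, dilWeight D x z ^ (-m) ∂dilMeasure D = ∫⁻ z : E, ENNReal.ofReal (1 + ‖z‖) ^ (-m) := by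
  rw [← lintegral_dilMeasure D (fun z => ENNReal.ofReal (1 + ‖z‖) ^ (-m)),
    ← lintegral_add_left_eq_self (μ := dilMeasure D) (fun z => dilWeight D x z ^ (-m)) x]
  simp [dilWeight]

/-- The pointwise inequality of Peetre and Fefferman-Stein for functions with spectrum in the
dilated set `D (supp χ)`; the constant does not depend on `D`. -/
theorem exists_rpow_mul_dilWeight_le (χ : 𝓢(E, ℂ)) {t : ℝ} (ht : 0 < t) (ht1 : t ≤ 1) {m : ℝ}
    (hm : 0 ≤ m) : ∃ K : ℝ≥0, ∀ D : E ≃L[ℝ] E, (∀ x y, inner ℝ (D x) y = inner ℝ x (D y)) →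
      (∀ x, ‖x‖ ≤ ‖D x‖) → ∀ (v : 𝓢'(E, ℂ)) (f : E → ℂ), Continuous f → Represents v f →
      TemperedDistribution.fourierMultiplierCLM ℂ (fun ξ => χ (D.symm ξ)) v = v → ∀ x y,
      ‖f y‖ₑ ^ t * dilWeight D x y ^ (-m) ≤
        K * ∫⁻ z, ‖f z‖ₑ ^ t * dilWeight D x z ^ (-m) ∂dilMeasure D := by
  choose K hK using exists_enorm_le_weight (𝓕 χ)
  -- The weight exponent `m / t` becomes `m` after taking `t`-th powers. The growth constants `A`,
  -- `N` below depend on `v` and `D`, but do not enter the result.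
  refine ⟨K (m / t), fun D hD hexp v f hf hv hχ x y => ?_⟩
  set χD := SchwartzMap.compCLMOfContinuousLinearEquiv ℂ D.symm χ with hχD
  have hrep : ∀ y, f y = v ((𝓕 χD).compSubConstCLM ℂ y) := eq_apply_compSubConst hf hv hχ
  have hF : ∀ (M : ℝ) (y : E),
      ‖f y‖ₑ ≤ K M * ∫⁻ z, ‖f z‖ₑ * dilWeight D y z ^ (-M) ∂dilMeasure D := fun M y => by
    rw [hrep y, (hv _).2, dilMeasure, lintegral_smul_measure, smul_eq_mul, ← mul_assoc,
      ← lintegral_const_mul' _ _ (by finiteness)]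
    refine (enorm_integral_le_lintegral_enorm _).trans (lintegral_mono fun z => ?_)
    have h1 : ((𝓕 χD).compSubConstCLM ℂ y) z = 𝓕 χD (z - y) := rfl
    rw [h1, hχD, fourier_comp_symm_apply χ D hD, enorm_mul, enorm_mul]
    have h2 : ‖((|LinearMap.det ((D : E →L[ℝ] E) : E →ₗ[ℝ] E)| : ℝ) : ℂ)‖ₑ =
        ENNReal.ofReal |LinearMap.det ((D : E →L[ℝ] E) : E →ₗ[ℝ] E)| := by
      rw [← ofReal_norm]; simp
    have h3 := hK M (D (z - y))
    rw [← norm_neg, ← map_neg, neg_sub] at h3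
    rw [h2]
    calc _ ≤ ENNReal.ofReal |LinearMap.det ((D : E →L[ℝ] E) : E →ₗ[ℝ] E)| *
          (K M * ENNReal.ofReal (1 + ‖D (y - z)‖) ^ (-M)) * ‖f z‖ₑ := by gcongr
      _ = _ := by rw [dilWeight]; ring
  obtain ⟨A, N, hA0, hA⟩ := exists_norm_apply_compSubConst_le v (𝓕 χD)
  have hgrowth : ∀ y, ‖f y‖ₑ ≤ ENNReal.ofReal A * dilWeight D 0 y ^ (N : ℝ) := fun y => by
    rw [dilWeight, ENNReal.ofReal_rpow_of_nonneg (by positivity) (by positivity),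
      ← ENNReal.ofReal_mul hA0, ← ofReal_norm]
    refine ENNReal.ofReal_le_ofReal ?_
    rw [hrep y, Real.rpow_natCast]
    refine (hA y).trans ?_
    gcongr
    simpa using hexp y
  have := rpow_mul_weight_le_lintegral (μ := dilMeasure D) (b := dilWeight D)
    (F := fun z => ‖f z‖ₑ) (one_le_dilWeight D) (by simp [dilWeight])
    (fun _ _ => ENNReal.ofReal_ne_top) (dilWeight_triangle D) ht ht1
    (fun M _ => ⟨K M, ENNReal.coe_ne_top, hF M⟩) ENNReal.ofReal_ne_top 0 (Nat.cast_nonneg N)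
    hgrowth (M₀ := m / t) (by positivity) (hF (m / t)) x y
  rwa [div_mul_cancel₀ _ ht.ne'] at this

end BandLimited
end MixedNormBesov

namespace MixedNormBesov

/-! ### Local suprema of one band-limited function -/

section Anisotropic

variable {n : ℕ}

/-- The quasi-homogeneous dilation as a linear equivalence. -/
noncomputable def anisoEquiv (a : Fin n → ℝ) (t : ℝ) (ht : 0 < t) : Rn n ≃L[ℝ] Rn n :=
  LinearEquiv.toContinuousLinearEquiv
    { toFun := anisoDilation a t
      invFun := anisoDilation a t⁻¹
      map_add' := fun x y => by ext i; simp [anisoDilation, mul_add]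
      map_smul' := fun c x => by ext i; simp [anisoDilation, mul_left_comm]
      left_inv := fun x => by
        ext i
        simp [anisoDilation, Real.inv_rpow ht.le, (Real.rpow_pos_of_pos ht _).ne']
      right_inv := fun x => by
        ext i
        simp [anisoDilation, Real.inv_rpow ht.le, (Real.rpow_pos_of_pos ht _).ne'] }

lemma anisoEquiv_apply (a : Fin n → ℝ) (t : ℝ) (ht : 0 < t) (x : Rn n) :
    anisoEquiv a t ht x = anisoDilation a t x := rfl

lemma anisoEquiv_inner (a : Fin n → ℝ) (t : ℝ) (ht : 0 < t) (x y : Rn n) :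
    inner ℝ (anisoEquiv a t ht x) y = inner ℝ x (anisoEquiv a t ht y) := by
  simp only [anisoEquiv_apply, anisoDilation, PiLp.inner_apply]
  refine Finset.sum_congr rfl fun i _ => ?_
  simp
  ring

lemma norm_le_norm_anisoDilation {a : Fin n → ℝ} (ha : ∀ i, 1 ≤ a i) {t : ℝ} (ht : 1 ≤ t)
    (x : Rn n) : ‖x‖ ≤ ‖anisoDilation a t x‖ := by
  rw [EuclideanSpace.norm_eq, EuclideanSpace.norm_eq]
  refine Real.sqrt_le_sqrt (Finset.sum_le_sum fun i _ => ?_)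
  simp only [anisoDilation, norm_mul]
  have h1 : 1 ≤ ‖t ^ a i‖ := (Real.one_le_rpow ht (by linarith [ha i])).trans (le_abs_self _)
  gcongr
  exact le_mul_of_one_le_left (norm_nonneg _) h1

lemma norm_anisoDilation_le {a : Fin n → ℝ} (ha : ∀ i, 1 ≤ a i) {t : ℝ} (ht0 : 0 < t) (ht : t ≤ 1)
    (x : Rn n) : ‖anisoDilation a t x‖ ≤ t * ‖x‖ := by
  rw [EuclideanSpace.norm_eq, EuclideanSpace.norm_eq, ← Real.sqrt_sq ht0.le,
    ← Real.sqrt_mul (sq_nonneg _), Finset.mul_sum, Real.sqrt_sq ht0.le]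
  refine Real.sqrt_le_sqrt (Finset.sum_le_sum fun i _ => ?_)
  simp only [anisoDilation, norm_mul, mul_pow]
  gcongr
  rw [Real.norm_of_nonneg (by positivity)]
  simpa using Real.rpow_le_rpow_of_exponent_ge ht0 ht (ha i)

/-- The smallest of `1` and the exponents. -/
noncomputable def minExponent (p : Fin n → ℝ≥0∞) : ℝ := (min 1 (⨅ i, p i)).toReal

lemma ofReal_minExponent (p : Fin n → ℝ≥0∞) :
    ENNReal.ofReal (minExponent p) = min 1 (⨅ i, p i) :=
  ENNReal.ofReal_toReal ((min_le_left _ _).trans_lt ENNReal.one_lt_top).ne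

lemma minExponent_le_one (p : Fin n → ℝ≥0∞) : minExponent p ≤ 1 := by
  rw [← ENNReal.ofReal_le_one, ofReal_minExponent]; exact min_le_left _ _

lemma ofReal_minExponent_le (p : Fin n → ℝ≥0∞) (i : Fin n) :
    ENNReal.ofReal (minExponent p) ≤ p i := by
  rw [ofReal_minExponent]; exact (min_le_right _ _).trans (iInf_le _ _)

lemma minExponent_pos {p : Fin n → ℝ≥0∞} (hp : ∀ i, 0 < p i) : 0 < minExponent p := by
  rw [← ENNReal.ofReal_pos, ofReal_minExponent, lt_min_iff]
  refine ⟨one_pos, ?_⟩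
  cases isEmpty_or_nonempty (Fin n)
  · rw [iInf_of_empty]; exact ENNReal.zero_lt_top
  · obtain ⟨i, hi⟩ := exists_eq_ciInf_of_finite (f := p)
    rw [← hi]; exact hp i

/-- The grid of points `k / R` in `[-C - 1 / R, C + 1 / R]`. -/
noncomputable def grid (C R : ℝ) : Finset ℝ :=
  (Finset.Icc (-⌈C * R⌉) ⌈C * R⌉).image fun i : ℤ => (i : ℝ) / R

lemma card_grid_le {C R : ℝ} (hC : 0 < C) (hR : 1 ≤ R) : ((grid C R).card : ℝ) ≤ (2 * C + 3) * R := by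
  have h0 : 0 ≤ ⌈C * R⌉ := Int.ceil_nonneg (by positivity)
  have h1 : (grid C R).card ≤ (⌈C * R⌉ + 1 - -⌈C * R⌉).toNat := by
    rw [← Int.card_Icc]; exact Finset.card_image_le
  have h2 : ((⌈C * R⌉ + 1 - -⌈C * R⌉).toNat : ℝ) = 2 * ⌈C * R⌉ + 1 := by
    have : (((⌈C * R⌉ + 1 - -⌈C * R⌉).toNat : ℤ) : ℝ) = 2 * ⌈C * R⌉ + 1 := by
      rw [Int.toNat_of_nonneg (by linarith)]; push_cast; ring
    exact_mod_cast this
  have h3 := Int.ceil_lt_add_one (C * R)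
  calc ((grid C R).card : ℝ) ≤ 2 * ⌈C * R⌉ + 1 := by rw [← h2]; exact_mod_cast h1
    -- Here `2⌈CR⌉ + 1 ≤ 2CR + 3`, and `3 ≤ 3R` because `R ≥ 1`.
    _ ≤ (2 * C + 3) * R := by nlinarith

lemma exists_mem_grid {C R z : ℝ} (hR : 0 < R) (hz : |z| < C) :
    ∃ k ∈ grid C R, |R * (k - z)| ≤ 1 := by
  refine ⟨(⌊z * R⌋ : ℝ) / R, Finset.mem_image.2 ⟨⌊z * R⌋, Finset.mem_Icc.2 ⟨?_, ?_⟩, rfl⟩, ?_⟩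
  · refine Int.le_floor.2 ?_
    push_cast
    have := Int.le_ceil (C * R)
    have := (abs_lt.1 hz).1
    nlinarith
  · have h1 := Int.floor_le (z * R)
    have h2 := Int.le_ceil (C * R)
    have := (abs_lt.1 hz).2
    have h3 : ((⌊z * R⌋ : ℤ) : ℝ) ≤ (⌈C * R⌉ : ℤ) := by nlinarith
    exact_mod_cast h3
  · have h : R * ((⌊z * R⌋ : ℝ) / R - z) = ⌊z * R⌋ - z * R := by field_simp
    rw [h, abs_le]
    constructor <;> linarith [Int.floor_le (z * R), Int.lt_floor_add_one (z * R)]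

/-- The averages `(∫ |f(z)|^t (1 + |D(x-z)|)^{-m} dz)^{1/t}` in the dilated coordinates. -/
noncomputable def dilAverage (D : Rn n ≃L[ℝ] Rn n) (t m : ℝ) (f : Rn n → ℂ) (x : Fin n → ℝ) : ℝ≥0∞ :=
  (∫⁻ z, ‖f z‖ₑ ^ t * dilWeight D (WithLp.toLp 2 x) z ^ (-m) ∂dilMeasure D) ^ t⁻¹

lemma measurable_dilAverage (D : Rn n ≃L[ℝ] Rn n) (t m : ℝ) {f : Rn n → ℂ} (hf : Continuous f) :
    Measurable (dilAverage D t m f) := by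
  refine Measurable.pow_const ?_ _
  refine Measurable.lintegral_prod_right' (f := fun z : (Fin n → ℝ) × Rn n =>
    ‖f z.2‖ₑ ^ t * dilWeight D (WithLp.toLp 2 z.1) z.2 ^ (-m)) ?_
  have h1 : Measurable fun z : (Fin n → ℝ) × Rn n => ‖f z.2‖ₑ ^ t :=
    ((hf.measurable.comp measurable_snd).enorm).pow_const _
  have h2 : Continuous fun z : (Fin n → ℝ) × Rn n => (1 + ‖D (WithLp.toLp 2 z.1 - z.2)‖ : ℝ) := by
    have : Continuous fun z : (Fin n → ℝ) × Rn n => (WithLp.toLp 2 z.1 : Rn n) :=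
      (PiLp.continuous_toLp 2 _).comp continuous_fst
    fun_prop
  exact h1.mul ((h2.measurable.ennreal_ofReal).pow_const _)

/-- After the substitution `z ↦ x + z` the average is an `L_t` mean of translates of `f` with
respect to the weight as a measure. The norm is translation invariant, so only the total mass of the
weight remains, and that does not depend on `D`. -/
lemma mixedNormAux_dilAverage_le {p : Fin n → ℝ≥0∞} {t : ℝ} (ht : 0 < t)
    (hp : ∀ i, ENNReal.ofReal t ≤ p i) (D : Rn n ≃L[ℝ] Rn n) (m : ℝ) {f : Rn n → ℂ}
    (hf : Continuous f) :
    mixedNormAux n p (dilAverage D t m f) ≤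
      (∫⁻ z : Rn n, ENNReal.ofReal (1 + ‖z‖) ^ (-m)) ^ t⁻¹ * mixedNorm p fun x => ‖f x‖ₑ := by
  set w : Rn n → ℝ≥0∞ := fun z => dilWeight D 0 z ^ (-m) with hw
  have hwm : Measurable w := by
    have : Continuous fun z : Rn n => (1 + ‖D (0 - z)‖ : ℝ) := by fun_prop
    exact (this.measurable.ennreal_ofReal).pow_const _
  have hfm : Measurable fun x : Fin n → ℝ => ‖f (WithLp.toLp 2 x)‖ₑ :=
    (hf.comp (PiLp.continuous_toLp 2 _)).measurable.enorm
  set ν := (dilMeasure D).withDensity w with hν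
  have hGm : Measurable (Function.uncurry fun (z : Rn n) (x : Fin n → ℝ) =>
      ‖f (WithLp.toLp 2 (x + WithLp.ofLp z))‖ₑ) := by
    have h1 : Continuous fun q : Rn n × (Fin n → ℝ) => (WithLp.toLp 2 (q.2 + WithLp.ofLp q.1) : Rn n) :=
      (PiLp.continuous_toLp 2 _).comp
        (continuous_snd.add ((PiLp.continuous_ofLp 2 _).comp continuous_fst))
    exact (hf.comp h1).measurable.enorm
  have key := mixedNormAux_rpow_le_lintegral (ν := ν) ht hp hGm (h := dilAverage D t m f) (by
    intro x
    have hx : Measurable fun z : Rn n => ‖f (WithLp.toLp 2 (x + WithLp.ofLp z))‖ₑ ^ t :=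
      (hGm.comp measurable_prodMk_right).pow_const t
    rw [dilAverage, ← ENNReal.rpow_mul, inv_mul_cancel₀ ht.ne', ENNReal.rpow_one,
      ← lintegral_add_left_eq_self (μ := dilMeasure D) _ (WithLp.toLp 2 x),
      hν, lintegral_withDensity_eq_lintegral_mul _ hwm hx]
    refine le_of_eq (lintegral_congr fun z => ?_)
    simp only [Pi.mul_apply, hw, mul_comm]
    congr 1
    simp [dilWeight])
  have h2 : ∀ z : Rn n, mixedNormAux n p (fun x => ‖f (WithLp.toLp 2 (x + WithLp.ofLp z))‖ₑ) =
      mixedNorm p fun x => ‖f x‖ₑ := fun z => mixedNormAux_add_right p hfm (WithLp.ofLp z)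
  simp only [h2, lintegral_const] at key
  have h3 : ν Set.univ = ∫⁻ z : Rn n, ENNReal.ofReal (1 + ‖z‖) ^ (-m) := by
    rw [hν, withDensity_apply _ .univ, Measure.restrict_univ, hw, lintegral_dilWeight]
  rw [h3, ← ENNReal.le_rpow_inv_iff ht, ENNReal.mul_rpow_of_nonneg _ _ (by positivity),
    ← ENNReal.rpow_mul, mul_inv_cancel₀ ht.ne', ENNReal.rpow_one, mul_comm] at key
  exact key

lemma norm_anisoDilation_sub_le {a : Fin n → ℝ} {t : ℝ} {z k : Fin n → ℝ}
    (h : ∀ i, |t ^ a i * (k i - z i)| ≤ 1) :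
    ‖anisoDilation a t (WithLp.toLp 2 k - WithLp.toLp 2 z)‖ ≤ √n := by
  rw [EuclideanSpace.norm_eq]
  refine Real.sqrt_le_sqrt ?_
  calc _ ≤ ∑ _i : Fin n, (1 : ℝ) := Finset.sum_le_sum fun i _ => by
        have := h i
        simp only [anisoDilation, Real.norm_eq_abs, sq_abs]
        exact (sq_le_one_iff_abs_le_one _).2 (by simpa using this)
    _ = n := by simp

lemma one_div_le_of_iInf_inv_lt {p : Fin n → ℝ≥0∞} {r : Fin n → ℝ}
    (hr : ∀ l, (⨅ (k : Fin n) (_ : k ≤ l), p k)⁻¹ < ENNReal.ofReal (r l)) {l i : Fin n}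
    (hi : i ≤ l) : ENNReal.ofReal (1 / r l) ≤ p i := by
  have h0 : 0 < r l := by
    rw [← ENNReal.ofReal_pos]; exact zero_le.trans_lt (hr l)
  rw [one_div, ENNReal.ofReal_inv_of_pos h0]
  exact (ENNReal.inv_le_iff_inv_le.1 (hr l).le).trans (iInf₂_le i hi)

/-- The estimate of the local supremum for a single band-limited function. -/
theorem exists_mixedNorm_iSup_le {a : Fin n → ℝ} (ha : ∀ i, 1 ≤ a i) {p : Fin n → ℝ≥0∞}
    (hp : ∀ i, 0 < p i) {r : Fin n → ℝ}
    (hr : ∀ l, (⨅ (k : Fin n) (_ : k ≤ l), p k)⁻¹ < ENNReal.ofReal (r l)) {C : ℝ} (hC : 0 < C)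
    (χ : 𝓢(Rn n, ℂ)) : ∃ c : ℝ≥0, ∀ (R : ℝ) (hR : 1 ≤ R) (v : 𝓢'(Rn n, ℂ)) (f : Rn n → ℂ),
      Continuous f → Represents v f →
      TemperedDistribution.fourierMultiplierCLM ℂ
        (fun ξ => χ ((anisoEquiv a R (zero_lt_one.trans_le hR)).symm ξ)) v = v →
      mixedNorm p (fun x => ⨆ (y : Rn n) (_ : ‖x - y‖ < C), ‖f y‖ₑ) ≤
        c * ENNReal.ofReal (R ^ ∑ l, a l * r l) * mixedNorm p fun x => ‖f x‖ₑ := by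
  have hr0 : ∀ l, 0 < r l := fun l => by
    rw [← ENNReal.ofReal_pos]; exact zero_le.trans_lt (hr l)
  set t := minExponent p with ht
  have ht0 : 0 < t := minExponent_pos hp
  -- Any `m > n` makes the weight `(1 + |z|)^{-m}` integrable.
  set m : ℝ := n + 1 with hm
  have hm0 : 0 ≤ m := by positivity
  obtain ⟨K, hK⟩ := exists_rpow_mul_dilWeight_le χ ht0 (minExponent_le_one p) hm0
  set I : ℝ≥0∞ := ∫⁻ z : Rn n, ENNReal.ofReal (1 + ‖z‖) ^ (-m) with hI
  have hItop : I ≠ ∞ := by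
    have h1 := finite_integral_one_add_norm (E := Rn n) (μ := volume) (r := m) (by simp [hm])
    refine (lt_of_eq_of_lt (lintegral_congr fun z => ?_) h1).ne
    rw [ENNReal.ofReal_rpow_of_pos (by positivity)]
  set B : ℝ≥0∞ := (ENNReal.ofReal (1 + √n) ^ m * K) ^ t⁻¹ with hB
  have hBtop : B ≠ ∞ := by
    have : 0 ≤ t⁻¹ := by positivity
    rw [hB]; finiteness
  set P : ℝ≥0∞ := ENNReal.ofReal (∏ l, (2 * C + 3) ^ r l) with hP
  have hc : B * P * I ^ t⁻¹ ≠ ∞ := by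
    have : 0 ≤ t⁻¹ := by positivity
    rw [hP]; finiteness
  refine ⟨(B * P * I ^ t⁻¹).toNNReal, fun R hR v f hf hv hχ => ?_⟩
  rw [ENNReal.coe_toNNReal hc]
  have hR0 : 0 < R := zero_lt_one.trans_le hR
  set D := anisoEquiv a R hR0 with hD
  have hpeetre := hK D (anisoEquiv_inner a R hR0) (norm_le_norm_anisoDilation ha hR) v f hf hv hχ
  have hRa : ∀ l, 1 ≤ R ^ a l := fun l => Real.one_le_rpow hR (by linarith [ha l])
  set S : Fin n → Finset ℝ := fun l => grid C (R ^ a l) with hS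
  set G := dilAverage D t m f with hG
  -- Each `y` in the ball has a grid point `x + k` with `‖D (x + k - y)‖ ≤ √n`, so the weight in the
  -- maximal inequality at `x + k` is at most a constant, which is collected in `B`.
  have hpoint : ∀ x : Fin n → ℝ, ⨆ (y : Rn n) (_ : ‖WithLp.toLp 2 x - y‖ < C), ‖f y‖ₑ ≤
      (B.toNNReal : ℝ≥0∞) * ⨆ (k : Fin n → ℝ) (_ : ∀ i, k i ∈ S i), G (x + k) := by
    intro x
    rw [ENNReal.coe_toNNReal hBtop]
    refine iSup₂_le fun y hy => ?_
    have hz : ∀ i, |y i - x i| < C := fun i => by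
      refine lt_of_le_of_lt ?_ hy
      rw [norm_sub_rev]
      exact (PiLp.norm_apply_le (y - WithLp.toLp 2 x) i)
    choose k hkS hk using fun i =>
      exists_mem_grid (R := R ^ a i) (zero_lt_one.trans_le (hRa i)) (hz i)
    have h1 : dilWeight D (WithLp.toLp 2 (x + k)) y ≤ ENNReal.ofReal (1 + √n) := by
      refine ENNReal.ofReal_le_ofReal ?_
      have := norm_anisoDilation_sub_le (a := a) (t := R) (z := fun i => y i - x i) (k := k) hk
      have h2 : (WithLp.toLp 2 (x + k) : Rn n) - y =
          WithLp.toLp 2 k - WithLp.toLp 2 (fun i => y i - x i) := by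
        ext i; simp; ring
      rw [h2]
      gcongr
      exact this
    have h2 := hpeetre (WithLp.toLp 2 (x + k)) y
    have hw0 : dilWeight D (WithLp.toLp 2 (x + k)) y ≠ 0 :=
      (zero_lt_one.trans_le (one_le_dilWeight _ _ _)).ne'
    have hwt : dilWeight D (WithLp.toLp 2 (x + k)) y ≠ ∞ := ENNReal.ofReal_ne_top
    have h3 : ‖f y‖ₑ ≤ B * G (x + k) := by
      rw [hB, hG, dilAverage, ← ENNReal.mul_rpow_of_nonneg _ _ (by positivity),
        ENNReal.le_rpow_inv_iff ht0]
      calc ‖f y‖ₑ ^ t = dilWeight D (WithLp.toLp 2 (x + k)) y ^ m *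
            (‖f y‖ₑ ^ t * dilWeight D (WithLp.toLp 2 (x + k)) y ^ (-m)) := by
            rw [mul_left_comm, ← ENNReal.rpow_add _ _ hw0 hwt]; simp
        _ ≤ _ := by rw [mul_assoc]; gcongr
    refine h3.trans ?_
    gcongr
    exact le_iSup₂ (f := fun (k : Fin n → ℝ) (_ : ∀ i, k i ∈ S i) => G (x + k)) k hkS
  have hgrid := mixedNormAux_iSup_grid_le S (t := fun l => 1 / r l)
    (fun l => one_div_pos.2 (hr0 l)) (fun l i hi => one_div_le_of_iInf_inv_lt hr hi)
    (measurable_dilAverage D t m hf)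
  -- Direction `l` has at most `(2C + 3) R^{a_l}` grid points, each count entering to the power
  -- `r_l`: this is the origin of `s = a · r`.
  have hcard : ((∏ l, ((S l).card : ℝ≥0) ^ (1 / (1 / r l)) : ℝ≥0) : ℝ≥0∞) ≤
      P * ENNReal.ofReal (R ^ ∑ l, a l * r l) := by
    rw [hP, ← ENNReal.ofReal_mul (by positivity), ← ENNReal.ofReal_coe_nnreal]
    refine ENNReal.ofReal_le_ofReal ?_
    rw [Real.rpow_sum_of_pos hR0, ← Finset.prod_mul_distrib]
    push_cast
    refine Finset.prod_le_prod (fun l _ => by positivity) fun l _ => ?_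
    rw [one_div_one_div, Real.rpow_mul hR0.le, ← Real.mul_rpow (by positivity) (by positivity)]
    exact Real.rpow_le_rpow (by positivity) (card_grid_le hC (hRa l)) (hr0 l).le
  calc mixedNorm p (fun x => ⨆ (y : Rn n) (_ : ‖x - y‖ < C), ‖f y‖ₑ)
      ≤ B * mixedNormAux n p
          (fun x => ⨆ (k : Fin n → ℝ) (_ : ∀ i, k i ∈ S i), G (x + k)) := by
        refine (mixedNormAux_mono p hpoint).trans ((mixedNormAux_const_mul_le p _ _).trans ?_)
        rw [ENNReal.coe_toNNReal hBtop]
    _ ≤ B * ((P * ENNReal.ofReal (R ^ ∑ l, a l * r l)) *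
          (I ^ t⁻¹ * mixedNorm p fun x => ‖f x‖ₑ)) := by
        gcongr
        exact hgrid.trans (mul_le_mul' hcard
          (mixedNormAux_dilAverage_le ht0 (ofReal_minExponent_le p) D m hf))
    _ = _ := by ring

end Anisotropic
end MixedNormBesov

namespace MixedNormBesov

/-! ### The anisotropic Littlewood-Paley decomposition -/

section LittlewoodPaley

open Filter Topology FourierTransform

variable {n : ℕ}

lemma anisoDilation_smul (a : Fin n → ℝ) (t c : ℝ) (x : Rn n) :
    anisoDilation a t (c • x) = c • anisoDilation a t x := by
  ext i; simp [anisoDilation, mul_left_comm]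

lemma anisoDilation_anisoDilation (a : Fin n → ℝ) {s t : ℝ} (hs : 0 ≤ s) (ht : 0 ≤ t) (x : Rn n) :
    anisoDilation a s (anisoDilation a t x) = anisoDilation a (s * t) x := by
  ext i; simp [anisoDilation, Real.mul_rpow hs ht, mul_assoc]

lemma anisoDilation_one (a : Fin n → ℝ) (x : Rn n) : anisoDilation a 1 x = x := by
  ext i; simp [anisoDilation]

/-- The dilation by the factor `2 ^ j`. -/
noncomputable def dyadicDil (a : Fin n → ℝ) (j : ℕ) : Rn n ≃L[ℝ] Rn n :=
  anisoEquiv a ((2 : ℝ) ^ j) (by positivity)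

lemma dyadicDil_symm_apply (a : Fin n → ℝ) (j : ℕ) (x : Rn n) :
    (dyadicDil a j).symm x = anisoDilation a ((2 : ℝ) ^ j)⁻¹ x := rfl

lemma anisoDilation_two_dyadicDil_symm (a : Fin n → ℝ) (j : ℕ) (x : Rn n) :
    anisoDilation a 2 ((dyadicDil a (j + 1)).symm x) = (dyadicDil a j).symm x := by
  rw [dyadicDil_symm_apply, dyadicDil_symm_apply,
    anisoDilation_anisoDilation a (by norm_num) (by positivity)]
  congr 1
  rw [pow_succ]; field_simp

/-- As `a_i ≥ 1`, the inverse dilations have norm at most `2^{-j}`. -/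
lemma tendsto_norm_dyadicDil_symm {a : Fin n → ℝ} (ha : ∀ i, 1 ≤ a i) :
    Tendsto (fun j => ‖((dyadicDil a j).symm : Rn n →L[ℝ] Rn n)‖) atTop (𝓝 0) := by
  have h : Tendsto (fun j : ℕ => ((2 : ℝ) ^ j)⁻¹) atTop (𝓝 0) :=
    tendsto_inv_atTop_zero.comp (tendsto_pow_atTop_atTop_of_one_lt one_lt_two)
  refine squeeze_zero (fun _ => norm_nonneg _) (fun j => ?_) h
  refine ContinuousLinearMap.opNorm_le_bound _ (by positivity) fun x => ?_
  exact norm_anisoDilation_le ha (by positivity) (inv_le_one_of_one_le₀ (one_le_pow₀ one_le_two)) x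

/-- The symbol of the blocks with `j = 0`. -/
lemma exists_schwartz_cutoff {a : Fin n → ℝ} {ψ : Rn n → ℝ} (hψ : IsCutoff a ψ) :
    ∃ Ψ : 𝓢(Rn n, ℂ), HasCompactSupport Ψ ∧ Ψ 0 = 1 ∧ ∀ ξ, Ψ ξ = (ψ ((2 * Real.pi) • ξ) : ℂ) := by
  have h2 : (2 * Real.pi) ≠ 0 := by positivity
  have h1 : HasCompactSupport fun ξ : Rn n => ((ψ ((2 * Real.pi) • ξ) : ℝ) : ℂ) :=
    (hψ.hasCompactSupport.comp_homeomorph (Homeomorph.smulOfNeZero _ h2)).comp_left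
      (g := fun r : ℝ => (r : ℂ)) (by simp)
  have h3 : ContDiff ℝ ((⊤ : ℕ∞) : WithTop ℕ∞) fun ξ : Rn n => ((ψ ((2 * Real.pi) • ξ) : ℝ) : ℂ) :=
    Complex.ofRealCLM.contDiff.comp (hψ.contDiff.comp (contDiff_const_smul _))
  refine ⟨h1.toSchwartzMap h3, h1, ?_, fun ξ => rfl⟩
  change ((ψ ((2 * Real.pi) • (0 : Rn n)) : ℝ) : ℂ) = 1
  rw [smul_zero, hψ.eq_one]
  · simp
  -- No dilate of `0` lies on the unit sphere, so the infimum is `sInf ∅ = 0`.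
  · have h0 : anisoDist a (0 : Rn n) = 0 := by
      have : ∀ t : ℝ, anisoDilation a t (0 : Rn n) = 0 := fun t => by
        ext i; simp [anisoDilation]
      simp [anisoDist, this]
    rw [h0]; exact zero_le_one

lemma dyadicPiece_zero_smul {a : Fin n → ℝ} {ψ : Rn n → ℝ} {Ψ : 𝓢(Rn n, ℂ)}
    (hΨ : ∀ ξ, Ψ ξ = (ψ ((2 * Real.pi) • ξ) : ℂ)) (ξ : Rn n) :
    (dyadicPiece a ψ 0 ((2 * Real.pi) • ξ) : ℂ) = Ψ ((dyadicDil a 0).symm ξ) := by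
  rw [dyadicDil_symm_apply, pow_zero, inv_one, anisoDilation_one, hΨ]
  rfl

lemma dyadicPiece_succ_smul {a : Fin n → ℝ} {ψ : Rn n → ℝ} {Ψ : 𝓢(Rn n, ℂ)}
    (hΨ : ∀ ξ, Ψ ξ = (ψ ((2 * Real.pi) • ξ) : ℂ)) (j : ℕ) (ξ : Rn n) :
    (dyadicPiece a ψ (j + 1) ((2 * Real.pi) • ξ) : ℂ) =
      Ψ ((dyadicDil a (j + 1)).symm ξ) - Ψ ((dyadicDil a j).symm ξ) := by
  have h : (2 : ℝ) ^ (-((j : ℝ) + 1)) = ((2 : ℝ) ^ (j + 1))⁻¹ := by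
    rw [Real.rpow_neg zero_le_two]; norm_cast
  rw [← anisoDilation_two_dyadicDil_symm a j, hΨ, hΨ, dyadicDil_symm_apply, ← anisoDilation_smul,
    ← anisoDilation_smul, ← anisoDilation_smul, ← h]
  simp [dyadicPiece]

lemma hasTemperateGrowth_dyadicPiece {a : Fin n → ℝ} {ψ : Rn n → ℝ} {Ψ : 𝓢(Rn n, ℂ)}
    (hΨ : ∀ ξ, Ψ ξ = (ψ ((2 * Real.pi) • ξ) : ℂ)) (j : ℕ) :
    (fun ξ : Rn n => (dyadicPiece a ψ j ((2 * Real.pi) • ξ) : ℂ)).HasTemperateGrowth := by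
  have h : ∀ k, (fun ξ : Rn n => Ψ ((dyadicDil a k).symm ξ)).HasTemperateGrowth := fun k =>
    hasTemperateGrowth_comp_clm Ψ ((dyadicDil a k).symm : Rn n →L[ℝ] Rn n)
  cases j with
  | zero => simpa only [dyadicPiece_zero_smul hΨ] using h 0
  | succ j =>
    simp only [dyadicPiece_succ_smul hΨ]
    exact (h (j + 1)).sub (h j)

lemma sum_dyadicPiece {a : Fin n → ℝ} {ψ : Rn n → ℝ} {Ψ : 𝓢(Rn n, ℂ)}
    (hΨ : ∀ ξ, Ψ ξ = (ψ ((2 * Real.pi) • ξ) : ℂ)) (J : ℕ) (ξ : Rn n) :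
    ∑ j ∈ Finset.range (J + 1), (dyadicPiece a ψ j ((2 * Real.pi) • ξ) : ℂ) =
      Ψ ((dyadicDil a J).symm ξ) := by
  rw [Finset.sum_range_succ', dyadicPiece_zero_smul hΨ]
  simp only [dyadicPiece_succ_smul hΨ]
  rw [Finset.sum_range_sub (fun j => Ψ ((dyadicDil a j).symm ξ))]
  ring

/-- The Littlewood-Paley decomposition of a tempered distribution converges. -/
lemma tendsto_sum_freqBlock {a : Fin n → ℝ} (ha : ∀ i, 1 ≤ a i) {ψ : Rn n → ℝ}
    (hψ : IsCutoff a ψ) (u : 𝓢'(Rn n, ℂ)) (φ : 𝓢(Rn n, ℂ)) :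
    Tendsto (fun J => ∑ j ∈ Finset.range (J + 1), freqBlock a ψ j u φ) atTop (𝓝 (u φ)) := by
  obtain ⟨Ψ, -, hΨ0, hΨ⟩ := exists_schwartz_cutoff hψ
  have h1 := tendsto_smulLeftCLM_comp Ψ (𝓕⁻ φ) (tendsto_norm_dyadicDil_symm ha)
  rw [hΨ0, one_smul] at h1
  have h2 : Tendsto (fun J => u (𝓕 (SchwartzMap.smulLeftCLM ℂ
      (fun ξ => Ψ ((dyadicDil a J).symm ξ)) (𝓕⁻ φ)))) atTop (𝓝 (u (𝓕 (𝓕⁻ φ)))) :=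
    ((u.continuous.comp
      (SchwartzMap.fourierTransformCLM (E := ℂ) (V := Rn n) ℂ).continuous).tendsto (𝓕⁻ φ)).comp h1
  rw [FourierTransform.fourier_fourierInv_eq] at h2
  refine h2.congr fun J => ?_
  have h4 := TemperedDistribution.fourierMultiplierCLM_sum ℂ (s := Finset.range (J + 1))
    (g := fun j ξ => (dyadicPiece a ψ j ((2 * Real.pi) • ξ) : ℂ))
    fun j _ => hasTemperateGrowth_dyadicPiece hΨ j
  simp only [sum_dyadicPiece hΨ] at h4
  have h5 := congrArg (fun T => T u φ) h4
  simp only [_root_.sum_apply] at h5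
  exact h5

/-- A `χ` equal to `1` on a ball containing the support of `Ψ` works for all `j`: the support of `Ψ
(2^a ·)` lies in the same ball, as `2^a` does not decrease norms. One `χ` for all blocks gives one
constant in the block estimate. -/
lemma exists_schwartz_one_on_support {a : Fin n → ℝ} (ha : ∀ i, 1 ≤ a i) {ψ : Rn n → ℝ}
    (hψ : IsCutoff a ψ) : ∃ χ : 𝓢(Rn n, ℂ), ∀ (j : ℕ) (u : 𝓢'(Rn n, ℂ)),
      TemperedDistribution.fourierMultiplierCLM ℂ (fun ξ => χ ((dyadicDil a j).symm ξ))
        (freqBlock a ψ j u) = freqBlock a ψ j u := by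
  obtain ⟨Ψ, hΨc, hΨ0, hΨ⟩ := exists_schwartz_cutoff hψ
  obtain ⟨M, hM⟩ := hΨc.isCompact.isBounded.subset_closedBall (0 : Rn n)
  have hball : ∀ ξ, Ψ ξ ≠ 0 → ‖ξ‖ ≤ M := fun ξ hξ => by
    simpa using hM (subset_tsupport _ hξ)
  have hM0 : 0 ≤ M := by simpa using hball 0 (by simp [hΨ0])
  let b : ContDiffBump (0 : Rn n) := ⟨M + 1, M + 2, by linarith, by linarith⟩
  have hb : HasCompactSupport fun ξ => ((b ξ : ℝ) : ℂ) :=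
    b.hasCompactSupport.comp_left (g := fun r : ℝ => (r : ℂ)) (by simp)
  let χ : 𝓢(Rn n, ℂ) := hb.toSchwartzMap (Complex.ofRealCLM.contDiff.comp b.contDiff)
  have hχ : ∀ ξ, ‖ξ‖ ≤ M → χ ξ = 1 := fun ξ hξ => by
    have : b ξ = 1 := b.one_of_mem_closedBall (by simpa using by linarith)
    change ((b ξ : ℝ) : ℂ) = 1
    simp [this]
  refine ⟨χ, fun j u => ?_⟩
  have hg : (fun ξ => χ ((dyadicDil a j).symm ξ)).HasTemperateGrowth :=
    hasTemperateGrowth_comp_clm χ ((dyadicDil a j).symm : Rn n →L[ℝ] Rn n)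
  rw [freqBlock, TemperedDistribution.fourierMultiplierCLM_fourierMultiplierCLM_apply
    (hasTemperateGrowth_dyadicPiece hΨ j) hg]
  congr 2
  ext ξ
  simp only [Pi.mul_apply]
  have h1 : ∀ ξ, Ψ ξ * χ ξ = Ψ ξ := fun ξ => by
    by_cases h : Ψ ξ = 0
    · simp [h]
    · rw [hχ ξ (hball ξ h), mul_one]
  have h2 : ∀ ξ, Ψ (anisoDilation a 2 ξ) * χ ξ = Ψ (anisoDilation a 2 ξ) := fun ξ => by
    by_cases h : Ψ (anisoDilation a 2 ξ) = 0
    · simp [h]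
    · rw [hχ ξ ((norm_le_norm_anisoDilation ha one_le_two ξ).trans (hball _ h)), mul_one]
  cases j with
  | zero => rw [dyadicPiece_zero_smul hΨ, h1]
  | succ j =>
    rw [dyadicPiece_succ_smul hΨ, sub_mul, h1, ← anisoDilation_two_dyadicDil_symm a j, h2]

end LittlewoodPaley
end MixedNormBesov

namespace MixedNormBesov

/-! ### Summation of the blocks and uniform convergence -/

section Summation

open Filter Topology

variable {n : ℕ}

lemma tsum_rpow_le {t : ℝ} (ht : 0 < t) (ht1 : t ≤ 1) (g : ℕ → ℝ≥0∞) :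
    (∑' j, g j) ^ t ≤ ∑' j, g j ^ t := by
  rw [← ENNReal.le_rpow_inv_iff ht]
  refine ENNReal.summable.tsum_le_of_sum_le fun s => ?_
  rw [ENNReal.le_rpow_inv_iff ht]
  refine le_trans ?_ (ENNReal.sum_le_tsum s)
  induction s using Finset.cons_induction with
  | empty => simp [ht]
  | cons i s hi ih =>
    rw [Finset.sum_cons, Finset.sum_cons]
    exact (ENNReal.rpow_add_le_add_rpow _ _ ht.le ht1).trans (by gcongr)

/-- The supremum over the balls of radius `C` is measurable. -/
lemma measurable_iSup_ball (C : ℝ) (f : Rn n → ℂ) :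
    Measurable fun x : Fin n → ℝ => ⨆ (y : Rn n) (_ : ‖WithLp.toLp 2 x - y‖ < C), ‖f y‖ₑ := by
  have h : Measurable fun x : Rn n => ⨆ (y : Rn n) (_ : ‖x - y‖ < C), ‖f y‖ₑ := by
    refine measurable_of_Ioi fun c => IsOpen.measurableSet ?_
    have : (fun x : Rn n => ⨆ (y : Rn n) (_ : ‖x - y‖ < C), ‖f y‖ₑ) ⁻¹' Set.Ioi c =
        ⋃ (y : Rn n) (_ : c < ‖f y‖ₑ), Metric.ball y C := by
      ext x
      simp [lt_iSup_iff, dist_eq_norm, and_comm]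
    rw [this]
    exact isOpen_biUnion fun y _ => Metric.isOpen_ball
  exact h.comp (PiLp.continuous_toLp 2 _).measurable

/-- The local supremum is at least `|f(y)|` on a whole cube around `y`, and cubes of a fixed size
have norms bounded below, wherever they lie. -/
lemma exists_enorm_le_mixedNorm_iSup {p : Fin n → ℝ≥0∞} (hp : ∀ i, 0 < p i) {C : ℝ} (hC : 0 < C) :
    ∃ κ : ℝ≥0, ∀ (f : Rn n → ℂ) (y : Rn n), ‖f y‖ₑ ≤
      κ * mixedNorm p (fun x => ⨆ (y : Rn n) (_ : ‖x - y‖ < C), ‖f y‖ₑ) := by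
  -- The cube of half-side `δ` lies in the ball of radius `C`, as `√n * δ < C`; the `+ 1` covers `n
  -- = 0`.
  obtain ⟨κ, hκ0, hκt, H⟩ := exists_pos_mul_le_mixedNormAux hp (δ := C / (√n + 1)) (by positivity)
  refine ⟨κ⁻¹.toNNReal, fun f y => ?_⟩
  rw [ENNReal.coe_toNNReal (ENNReal.inv_ne_top.2 hκ0), mul_comm, ← div_eq_mul_inv,
    ENNReal.le_div_iff_mul_le (Or.inl hκ0) (Or.inl hκt)]
  refine H _ (WithLp.ofLp y) _ fun x hx => ?_
  refine le_iSup₂ (f := fun (y : Rn n) (_ : ‖WithLp.toLp 2 x - y‖ < C) => ‖f y‖ₑ) y ?_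
  have hs : 0 ≤ √(n : ℝ) := Real.sqrt_nonneg _
  have h1 : ‖WithLp.toLp 2 x - y‖ ≤ √n * (C / (√n + 1)) := by
    rw [EuclideanSpace.norm_eq, ← Real.sqrt_sq (show 0 ≤ C / (√(n : ℝ) + 1) by positivity),
      ← Real.sqrt_mul (Nat.cast_nonneg n)]
    refine Real.sqrt_le_sqrt ?_
    calc _ ≤ ∑ _i : Fin n, (C / (√(n : ℝ) + 1)) ^ 2 := Finset.sum_le_sum fun i _ => by
          have := (hx i).le
          gcongr
          simpa using this
      _ = _ := by simp
  refine h1.trans_lt ?_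
  rw [mul_div_assoc', div_lt_iff₀ (by positivity)]
  nlinarith

/-- The reproducing formula expresses the values of any continuous representative through `v`, so
all representatives in the infimum coincide with `f`. -/
lemma mixedNorm_le_distMixedNorm {p : Fin n → ℝ≥0∞} {v : 𝓢'(Rn n, ℂ)} {f : Rn n → ℂ}
    (hf : Continuous f) (hv : Represents v f) {χ : Rn n → ℂ} (χ' : 𝓢(Rn n, ℂ)) (hχ' : ⇑χ' = χ)
    (hχ : TemperedDistribution.fourierMultiplierCLM ℂ χ v = v) :
    mixedNorm p (fun x => ‖f x‖ₑ) ≤ distMixedNorm p v := by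
  subst hχ'
  refine le_iInf₂ fun g hg => ?_
  have : f = g := funext fun y => by
    rw [eq_apply_compSubConst hf hv hχ, eq_apply_compSubConst hg.1 hg.2 hχ]
  rw [this]

/-- A series of functions which is dominated in the supremum norm represents the limit of the
partial sums. -/
lemma isRepresentedBy_tsum {u : 𝓢'(Rn n, ℂ)} {v : ℕ → 𝓢'(Rn n, ℂ)} {f : ℕ → Rn n → ℂ}
    (hf : ∀ j, Continuous (f j)) (hv : ∀ j, Represents (v j) (f j)) {b : ℕ → ℝ} (hb : Summable b)
    (hfb : ∀ j x, ‖f j x‖ ≤ b j)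
    (hu : ∀ φ, Tendsto (fun J => ∑ j ∈ Finset.range (J + 1), v j φ) atTop (𝓝 (u φ))) :
    Continuous (fun x => ∑' j, f j x) ∧ IsRepresentedBy u fun x => ∑' j, f j x := by
  have hcont := continuous_tsum hf hb hfb
  have hsum : ∀ x, Summable fun j => f j x := fun x => .of_norm_bounded hb fun j => hfb j x
  refine ⟨hcont, fun φ => ⟨?_, ?_⟩⟩
  · refine φ.integrable.mul_bdd (c := ∑' j, b j) hcont.aestronglyMeasurable
      (Eventually.of_forall fun x => ?_)
    exact tsum_of_norm_bounded hb.hasSum fun j => hfb j x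
  · have hint : ∀ j, ∫ x, ‖φ x * f j x‖ ≤ b j * ∫ x, ‖φ x‖ := fun j => by
      rw [← integral_const_mul]
      refine integral_mono ((hv j φ).1.norm) (φ.integrable.norm.const_mul _) fun x => ?_
      simp only [norm_mul]
      rw [mul_comm]
      gcongr
      exact hfb j x
    have h1 := hasSum_integral_of_summable_integral_norm (μ := volume)
      (F := fun j x => φ x * f j x) (fun j => (hv j φ).1)
      (.of_nonneg_of_le (fun j => integral_nonneg fun _ => norm_nonneg _) hint (hb.mul_right _))
    have h2 := h1.tendsto_sum_nat.comp (tendsto_add_atTop_nat 1)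
    have h3 := tendsto_nhds_unique (hu φ) (h2.congr fun J => by
      simp only [Function.comp_apply, (hv _ φ).2])
    rw [h3]
    simp only [tsum_mul_left]

end Summation
end MixedNormBesov

/-! ### The embedding and the estimate of the local supremum -/

theorem corollary3p3 {n : ℕ} (a : Fin n → ℝ) (ha : ∀ i, 1 ≤ a i)
    (ψ : MixedNormBesov.Rn n → ℝ) (hψ : MixedNormBesov.IsCutoff a ψ)
    (p : Fin n → ℝ≥0∞) (hp : ∀ i, 0 < p i)
    (r : Fin n → ℝ) (hr : ∀ l, (⨅ (k : Fin n) (_ : k ≤ l), p k)⁻¹ < ENNReal.ofReal (r l))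
    (C : ℝ) (hC : 0 < C) :
    ∃ c : ℝ≥0, ∀ u : 𝓢'(MixedNormBesov.Rn n, ℂ),
      MixedNormBesov.besovNorm a ψ (∑ l, a l * r l) p (min 1 (⨅ i, p i)) u < ∞ →
        ∃ g : MixedNormBesov.Rn n → ℂ, Continuous g ∧ MixedNormBesov.IsRepresentedBy u g ∧
          MixedNormBesov.mixedNorm p
              (fun x => ⨆ (y : MixedNormBesov.Rn n) (_ : ‖x - y‖ < C), ‖g y‖ₑ) ≤
            c * MixedNormBesov.besovNorm a ψ (∑ l, a l * r l) p (min 1 (⨅ i, p i)) u := by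
  obtain ⟨χ, hχ⟩ := MixedNormBesov.exists_schwartz_one_on_support ha hψ
  obtain ⟨c, hc⟩ := MixedNormBesov.exists_mixedNorm_iSup_le ha hp hr hC χ
  obtain ⟨κ, hκ⟩ := MixedNormBesov.exists_enorm_le_mixedNorm_iSup hp hC
  -- The constant for one block serves for the sum, since the `t`-triangle inequality has constant
  -- `1`; `κ` is used for uniform convergence only.
  refine ⟨c, fun u hu => ?_⟩
  set s := ∑ l, a l * r l with hs
  set t := MixedNormBesov.minExponent p with ht
  have ht0 : 0 < t := MixedNormBesov.minExponent_pos hp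
  have ht1 : t ≤ 1 := MixedNormBesov.minExponent_le_one p
  set A : ℕ → ℝ≥0∞ := fun j => (2 : ℝ≥0∞) ^ ((j : ℝ) * s) *
    MixedNormBesov.distMixedNorm p (MixedNormBesov.freqBlock a ψ j u) with hA
  have hnorm : MixedNormBesov.besovNorm a ψ s p (min 1 (⨅ i, p i)) u =
      (∑' j, A j ^ t) ^ t⁻¹ := by
    have hq : min 1 (⨅ i, p i) ≠ ∞ := ((min_le_left _ _).trans_lt ENNReal.one_lt_top).ne
    rw [MixedNormBesov.besovNorm, if_neg hq, one_div]
    congr 1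
    refine tsum_congr fun j => ?_
    rw [hA, ENNReal.mul_rpow_of_nonneg _ _ ht0.le, ← ENNReal.rpow_mul]
    rfl
  rw [hnorm] at hu ⊢
  have hsumt : ∑' j, A j ^ t ≠ ∞ := fun h => by
    rw [h, ENNReal.top_rpow_of_pos (inv_pos.2 ht0)] at hu
    exact lt_irrefl _ hu
  have hsumA : ∑' j, A j ≠ ∞ := fun h => by
    have := MixedNormBesov.tsum_rpow_le ht0 ht1 A
    rw [h, ENNReal.top_rpow_of_pos ht0, top_le_iff] at this
    exact hsumt this
  have h2 : ∀ j : ℕ, (2 : ℝ≥0∞) ^ ((j : ℝ) * s) = ENNReal.ofReal (((2 : ℝ) ^ j) ^ s) := fun j => by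
    rw [← Real.rpow_natCast, ← Real.rpow_mul zero_le_two, ← ENNReal.ofReal_rpow_of_pos two_pos]
    simp
  have hfin : ∀ j, MixedNormBesov.distMixedNorm p (MixedNormBesov.freqBlock a ψ j u) < ∞ := fun j => by
    have h1 : A j ≠ ∞ := ENNReal.ne_top_of_tsum_ne_top hsumA j
    refine lt_top_iff_ne_top.2 fun h => h1 ?_
    simp only [hA, h]
    refine ENNReal.mul_top ?_
    rw [h2]
    simpa using by positivity
  -- An infimum over no functions would be `∞`, so finiteness of the norm provides a continuous
  -- representative of the block.
  have hex : ∀ j, ∃ f : MixedNormBesov.Rn n → ℂ, Continuous f ∧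
      MixedNormBesov.Represents (MixedNormBesov.freqBlock a ψ j u) f := fun j => by
    obtain ⟨f, hf⟩ := iInf_lt_iff.1 (hfin j)
    obtain ⟨hf, -⟩ := iInf_lt_iff.1 hf
    exact ⟨f, hf⟩
  choose f hfc hfr using hex
  set S : ℕ → MixedNormBesov.Rn n → ℝ≥0∞ := fun j x =>
    ⨆ (y : MixedNormBesov.Rn n) (_ : ‖x - y‖ < C), ‖f j y‖ₑ with hS
  have hSA : ∀ j, MixedNormBesov.mixedNorm p (S j) ≤ c * A j := fun j => by
    refine (hc ((2 : ℝ) ^ j) (one_le_pow₀ one_le_two) _ (f j) (hfc j) (hfr j) (hχ j u)).trans ?_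
    simp only [hA]
    rw [h2, mul_assoc]
    gcongr
    exact MixedNormBesov.mixedNorm_le_distMixedNorm (hfc j) (hfr j)
      (SchwartzMap.compCLMOfContinuousLinearEquiv ℂ (MixedNormBesov.dyadicDil a j).symm χ) rfl
      (hχ j u)
  have hbound : ∀ j x, ‖f j x‖ₑ ≤ κ * (c * A j) := fun j x =>
    (hκ (f j) x).trans (by gcongr; exact hSA j)
  have hsumb : ∑' j, κ * (c * A j) ≠ ∞ := by
    rw [ENNReal.tsum_mul_left, ENNReal.tsum_mul_left]
    finiteness
  have hbj : ∀ j, κ * (c * A j) ≠ ∞ := fun j => ENNReal.ne_top_of_tsum_ne_top hsumb j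
  obtain ⟨hcont, hrep⟩ := MixedNormBesov.isRepresentedBy_tsum hfc hfr
    (ENNReal.summable_toReal hsumb)
    (fun j x => by
      rw [← toReal_enorm]
      exact ENNReal.toReal_mono (hbj j) (hbound j x))
    (MixedNormBesov.tendsto_sum_freqBlock ha hψ u)
  refine ⟨_, hcont, hrep, ?_⟩
  -- The local supremum of the sum is at most the sum of the local suprema `S j`, whose `t`-th power
  -- is at most `∑ S j ^ t` because `t ≤ 1`.
  have hfinal := MixedNormBesov.mixedNormAux_rpow_le_tsum (p := p) ht0
    (MixedNormBesov.ofReal_minExponent_le p)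
    (fun j => MixedNormBesov.measurable_iSup_ball C (f j))
    (h := fun x => ⨆ (y : MixedNormBesov.Rn n) (_ : ‖WithLp.toLp 2 x - y‖ < C), ‖∑' j, f j y‖ₑ)
    (fun x => by
      refine le_trans (ENNReal.rpow_le_rpow (iSup₂_le fun y hy => ?_) ht0.le)
        (MixedNormBesov.tsum_rpow_le ht0 ht1 _)
      refine enorm_tsum_le_tsum_enorm.trans (ENNReal.tsum_le_tsum fun j => ?_)
      exact le_iSup₂ (f := fun (y : MixedNormBesov.Rn n)
        (_ : ‖WithLp.toLp 2 x - y‖ < C) => ‖f j y‖ₑ) y hy)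
  have hle : ∑' j, MixedNormBesov.mixedNorm p (S j) ^ t ≤ (c * (∑' j, A j ^ t) ^ t⁻¹) ^ t := by
    rw [ENNReal.mul_rpow_of_nonneg _ _ ht0.le, ← ENNReal.rpow_mul, inv_mul_cancel₀ ht0.ne',
      ENNReal.rpow_one, ← ENNReal.tsum_mul_left]
    refine ENNReal.tsum_le_tsum fun j => ?_
    rw [← ENNReal.mul_rpow_of_nonneg _ _ ht0.le]
    exact ENNReal.rpow_le_rpow (hSA j) ht0.le
  exact (ENNReal.rpow_le_rpow_iff ht0).1 (hfinal.trans hle)
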